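/- Let $R$ be an associative ring with unit and let $M$ be an $R$-bimodule that is $N$-nilpotent for some integer $N\ge 0$, i.e. $M^{\otimes_R(N+1)}=0$, where $M^{\otimes_R 0}=R$ and $M^{\otimes_R(i+1)}=M\otimes_R M^{\otimes_R i}$. Let $T_R(M)=\bigoplus_{i=0}^N M^{\otimes_R i}$ be the tensor ring. Modules are left modules. A $T_R(M)$-module is the same thing as a pair $(X,u)$ of an $R$-module $X$ and an $R$-homomorphism $u\colon M\otimes_R X\to X$ (where $u(m\otimes x)=mx$). For an $R$-module $X$, let $\mathrm{Ind}(X)$ be the $T_R(M)$-module $\big(\bigoplus_{i=0}^N M^{\otimes_R i}\otimes_R X,\,c_X\big)$, where $c_X$ is the map that takes $M\otimes_R(M^{\otimes_R i}\otimes_R X)$ identically to the summand $M^{\otimes_R(i+1)}\otimes_R X$; thus $\mathrm{Ind}(X)\cong T_R(M)\otimes_R X$. For a ring $A$, a complete projective resolution of $A$-modules is an exact sequence $Q^\bullet=(\cdots\to Q^{-1}\to Q^0\to Q^1\to\cdots)$ of projective $A$-modules, indexed by $\mathbb Z$, that remains exact under $\mathrm{Hom}_A(-,P)$ for every projective $A$-module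 $P$. An $A$-module is Gorenstein projective if it is isomorphic to $\ker(Q^0\to Q^1)$ for some complete projective resolution $Q^\bullet$; $\mathrm{GP}(A)$ denotes the class of these modules. Suppose that $M$ is compatible: for every complete projective resolution $Q^\bullet$ of $T_R(M)$-modules, (C1) the complex $M\otimes_R Q^\bullet$ is exact, and (C2) the complex $\mathrm{Hom}_{T_R(M)}(Q^\bullet,\mathrm{Ind}(M\otimes_R P))$ is exact for every projective $R$-module $P$. Suppose also that $M$ is admissible: for every $G\in\mathrm{GP}(R)$, every projective $R$-module $P$ and every $i\ge 0$, $$\mathrm{Ext}^1_R(G,M^{\otimes_R i}\otimes_R P)=0=\mathrm{Tor}_1^R(M,M^{\otimes_R i}\otimes_R G).$$ Then $\mathrm{GP}(T_R(M))=\Phi(\mathrm{GP}(R))$, where $\Phi(\mathrm{GP}(R))$ is the class of the $T_R(M)$-modules $(X,u)$ such that $u$ is injective and $\mathrm{coker}(u)\in\mathrm{GP}(R)$. That is, a $T_R(M)$-module $(X,u)$ is Gorenstein projective if and only if $u$ is injective and $\mathrm{coker}(u)$ is a Gorenstein projective $R$-module. -/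

import Mathlib

open CategoryTheory TensorProduct MulOpposite

universe u

noncomputable section

namespace TensorRingGP

section BalancedTensor

variable (R : Type u) [Ring R]
variable (M : Type u) [AddCommGroup M] [Module R M] [Module Rᵐᵒᵖ M]
variable (X : Type u) [AddCommGroup X] [Module R X]

/-- For an `R`-bimodule `M` (commuting left and right actions, the right one written as an action
of `Rᵐᵒᵖ`), the relations `(m r) ⊗ x = m ⊗ (r x)`. The set of differences is stable under left
multiplication by `R`, so its left `R`-span is the additive subgroup that it generates. -/
def balancedRelations : Submodule R (M ⊗[ℤ] X) :=
  Submodule.span R {t | ∃ (m : M) (r : R) (x : X), t = (op r • m) ⊗ₜ[ℤ] x - m ⊗ₜ[ℤ] (r • x)}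

/-- The tensor product `M ⊗_R X` of an `R`-bimodule `M` and a left `R`-module `X` over a
not necessarily commutative ring `R`, as a left `R`-module. -/
def BTensor : Type u := (M ⊗[ℤ] X) ⧸ balancedRelations R M X

instance : AddCommGroup (BTensor R M X) :=
  inferInstanceAs (AddCommGroup ((M ⊗[ℤ] X) ⧸ balancedRelations R M X))

instance : Module R (BTensor R M X) :=
  inferInstanceAs (Module R ((M ⊗[ℤ] X) ⧸ balancedRelations R M X))

variable {M X}

/-- The pure tensor `m ⊗ x`. -/
def btmul (m : M) (x : X) : BTensor R M X :=
  (balancedRelations R M X).mkQ (m ⊗ₜ[ℤ] x)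

theorem btmul_add (m : M) (x y : X) : btmul R m (x + y) = btmul R m x + btmul R m y := by
  simp only [btmul, TensorProduct.tmul_add]
  exact map_add _ _ _

theorem btmul_zero (m : M) : btmul R m (0 : X) = 0 := by
  simp only [btmul, TensorProduct.tmul_zero]
  exact map_zero _

theorem add_btmul (m n : M) (x : X) : btmul R (m + n) x = btmul R m x + btmul R n x := by
  simp only [btmul, TensorProduct.add_tmul]
  exact map_add _ _ _

theorem smul_btmul (r : R) (m : M) (x : X) : btmul R (r • m) x = r • btmul R m x := by
  simp only [btmul, ← TensorProduct.smul_tmul']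
  exact map_smul (balancedRelations R M X).mkQ _ _

theorem op_smul_btmul (r : R) (m : M) (x : X) : btmul R (op r • m) x = btmul R m (r • x) := by
  refine (Submodule.Quotient.eq _).2 (Submodule.subset_span ⟨m, r, x, rfl⟩)

variable {R}

theorem btensor_induction {p : BTensor R M X → Prop} (t : BTensor R M X)
    (zero : p 0) (tmul : ∀ m x, p (btmul R m x)) (add : ∀ s t, p s → p t → p (s + t)) : p t := by
  obtain ⟨t, rfl⟩ := Submodule.mkQ_surjective (balancedRelations R M X) t
  induction t using TensorProduct.induction_on with
  | zero => rw [map_zero]; exact zero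
  | tmul m x => exact tmul m x
  | add s t hs ht => rw [map_add]; exact add _ _ hs ht

/-- The universal property of `M ⊗_R X`. -/
def btlift {Y : Type*} [AddCommGroup Y] [Module R Y] (f : M → X → Y)
    (hadd : ∀ m n x, f (m + n) x = f m x + f n x)
    (addh : ∀ m x y, f m (x + y) = f m x + f m y)
    (hsmul : ∀ (r : R) m x, f (r • m) x = r • f m x)
    (hbal : ∀ (r : R) m x, f (op r • m) x = f m (r • x)) : BTensor R M X →ₗ[R] Y :=
  (balancedRelations R M X).liftQ
    (TensorProduct.AlgebraTensorModule.lift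
      { toFun := fun m => (AddMonoidHom.mk' (f m) (addh m)).toIntLinearMap
        map_add' := fun m n => by ext x; exact hadd m n x
        map_smul' := fun r m => by ext x; exact hsmul r m x })
    (by
      rw [balancedRelations, Submodule.span_le]
      rintro _ ⟨m, r, x, rfl⟩
      simp [hbal])

@[simp]
theorem btlift_btmul {Y : Type*} [AddCommGroup Y] [Module R Y] (f : M → X → Y)
    (hadd addh hsmul hbal) (m : M) (x : X) :
    btlift (R := R) f hadd addh hsmul hbal (btmul R m x) = f m x := rfl

variable (R M)

/-- `M ⊗ f : M ⊗_R X → M ⊗_R Y` for an `R`-linear map `f : X → Y`. -/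
def btmap {Y : Type u} [AddCommGroup Y] [Module R Y] (f : X →ₗ[R] Y) :
    BTensor R M X →ₗ[R] BTensor R M Y :=
  btlift (fun m x => btmul R m (f x))
    (fun _ _ _ => add_btmul R _ _ _) (fun _ _ _ => by rw [map_add, btmul_add])
    (fun _ _ _ => smul_btmul R _ _ _) (fun _ _ _ => by rw [op_smul_btmul, map_smul])

@[simp]
theorem btmap_btmul {Y : Type u} [AddCommGroup Y] [Module R Y] (f : X →ₗ[R] Y) (m : M) (x : X) :
    btmap R M f (btmul R m x) = btmul R m (f x) := rfl

/-- The functor `M ⊗_R -`. -/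
def tensorFunctor : ModuleCat.{u} R ⥤ ModuleCat.{u} R where
  obj X := ModuleCat.of R (BTensor R M X)
  map f := ModuleCat.ofHom (btmap R M f.hom)
  map_id X := by
    ext t
    induction t using btensor_induction with
    | zero => simp
    | tmul m x => rfl
    | add s t hs ht => rw [map_add, map_add, hs, ht]
  map_comp f g := by
    ext t
    induction t using btensor_induction with
    | zero => simp
    | tmul m x => rfl
    | add s t hs ht => rw [map_add, map_add, hs, ht]

instance : (tensorFunctor R M).Additive where
  map_add {X Y f g} := by
    have h : btmap R M (f + g).hom = btmap R M f.hom + btmap R M g.hom := by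
      ext t
      induction t using btensor_induction with
      | zero => rw [map_zero, map_zero]
      | tmul m x => exact btmul_add R _ _ _
      | add s t hs ht => rw [map_add, map_add, hs, ht]
    exact congrArg ModuleCat.ofHom h

/-- `Tor_n^R(M, X)`: the left derived functors of `M ⊗_R -`. -/
def Tor (n : ℕ) (X : ModuleCat.{u} R) : ModuleCat.{u} R :=
  ((tensorFunctor R M).leftDerived n).obj X

/-- `M^{⊗ i} ⊗_R X`, bracketed to the right: `M ⊗ (M ⊗ (⋯ ⊗ (M ⊗ X)))`. -/
def tensorPow : ℕ → ModuleCat.{u} R → ModuleCat.{u} R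
  | 0, X => X
  | i + 1, X => ModuleCat.of R (BTensor R M (tensorPow i X))

/-- The bimodule `M` is `N`-nilpotent: `M^{⊗ (N + 1)} = 0`. -/
def IsNilpotentBimodule (N : ℕ) : Prop :=
  Subsingleton (tensorPow R M (N + 1) (ModuleCat.of R R))

/-- The pure tensor `m ⊗ y` in `M^{⊗ (i + 1)} ⊗_R X`, for `y` in `M^{⊗ i} ⊗_R X`. -/
def consTensor {X : ModuleCat.{u} R} (i : ℕ) (m : M) (y : tensorPow R M i X) :
    tensorPow R M (i + 1) X :=
  btmul R m y

end BalancedTensor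

section TensorRing

variable (R : Type u) [Ring R]
variable (M : Type u) [AddCommGroup M] [Module R M] [Module Rᵐᵒᵖ M]

/-- The left `R`-module `⨁ i, M^{⊗ i} ⊗_R X`. If `M` is `N`-nilpotent, the terms with
`i > N` are zero. -/
abbrev IndCarrier (X : ModuleCat.{u} R) : Type u := DirectSum ℕ fun i => tensorPow R M i X

/-- `y ↦ m ⊗ y`, taking `M^{⊗ i} ⊗_R X` to `M^{⊗ (i + 1)} ⊗_R X`. -/
def shift (X : ModuleCat.{u} R) (m : M) : IndCarrier R M X →+ IndCarrier R M X :=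
  DirectSum.toAddMonoid fun i =>
    (DirectSum.of (fun i => tensorPow R M i X) (i + 1)).comp
      (AddMonoidHom.mk' (consTensor R M i m) fun y z => btmul_add R m y z)

theorem shift_of (X : ModuleCat.{u} R) (m : M) (i : ℕ) (y : tensorPow R M i X) :
    shift R M X m (DirectSum.of (fun i => tensorPow R M i X) i y) =
      DirectSum.of (fun i => tensorPow R M i X) (i + 1) (consTensor R M i m y) :=
  DirectSum.toAddMonoid_of _ _ _

theorem smul_of (X : ModuleCat.{u} R) (r : R) (i : ℕ) (y : tensorPow R M i X) :
    r • DirectSum.of (fun i => tensorPow R M i X) i y =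
      DirectSum.of (fun i => tensorPow R M i X) i (r • y) :=
  ((DirectSum.lof R ℕ (fun i => tensorPow R M i X) i).map_smul r y).symm

/-- The structure map `c_X : M ⊗_R (⨁ i, M^{⊗ i} ⊗_R X) → ⨁ i, M^{⊗ i} ⊗_R X`. -/
def indMap (X : ModuleCat.{u} R) : BTensor R M (IndCarrier R M X) →ₗ[R] IndCarrier R M X :=
  btlift (fun m x => shift R M X m x)
    (fun m n x => by
      induction x using DirectSum.induction_on with
      | zero => simp
      | of i y =>
        simp only [shift_of, ← map_add]
        exact congrArg _ (add_btmul R m n y)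
      | add x y hx hy => simp only [map_add, hx, hy]; abel)
    (fun m x y => map_add _ _ _)
    (fun r m x => by
      induction x using DirectSum.induction_on with
      | zero => simp
      | of i y =>
        simp only [shift_of, smul_of]
        exact congrArg _ (smul_btmul R r m y)
      | add x y hx hy => simp only [map_add, hx, hy, smul_add])
    (fun r m x => by
      induction x using DirectSum.induction_on with
      | zero => simp
      | of i y =>
        simp only [shift_of, smul_of]
        exact congrArg _ (op_smul_btmul R r m y)
      | add x y hx hy => simp only [map_add, hx, hy, smul_add])

/-- The underlying additive group `⨁ i, M^{⊗ i}` of the tensor ring `T_R(M)`. If `M` is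
`N`-nilpotent, this is `⨁_{i = 0}^N M^{⊗ i}`. -/
def TensorRing : Type u := IndCarrier R M (ModuleCat.of R R)

instance : AddCommGroup (TensorRing R M) :=
  inferInstanceAs (AddCommGroup (IndCarrier R M (ModuleCat.of R R)))

instance : Module R (TensorRing R M) :=
  inferInstanceAs (Module R (IndCarrier R M (ModuleCat.of R R)))

namespace TensorRing

/-- The summand `M^{⊗ i}` of `T_R(M)`. -/
def of (i : ℕ) : tensorPow R M i (ModuleCat.of R R) →ₗ[R] TensorRing R M :=
  DirectSum.lof R ℕ (fun i => tensorPow R M i (ModuleCat.of R R)) i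

/-- The summand `R = M^{⊗ 0}` of `T_R(M)`. -/
def base : R →ₗ[R] TensorRing R M := of R M 0

/-- The map `M ⊗_R T_R(M) → T_R(M)`, `m ⊗ t ↦ m ⊗ t`. -/
def cons : BTensor R M (TensorRing R M) →ₗ[R] TensorRing R M := indMap R M (ModuleCat.of R R)

variable {R M}

theorem cons_of (i : ℕ) (m : M) (y : tensorPow R M i (ModuleCat.of R R)) :
    cons R M (btmul R m (of R M i y)) = of R M (i + 1) (consTensor R M i m y) :=
  shift_of R M (ModuleCat.of R R) m i y

theorem induction_of {p : TensorRing R M → Prop} (t : TensorRing R M) (zero : p 0)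
    (of : ∀ i y, p (of R M i y)) (add : ∀ s t, p s → p t → p (s + t)) : p t :=
  DirectSum.induction_on t zero of add

theorem induction {p : TensorRing R M → Prop} (t : TensorRing R M)
    (base : ∀ r : R, p (base R M r)) (cons : ∀ m t, p t → p (cons R M (btmul R m t)))
    (add : ∀ s t, p s → p t → p (s + t)) : p t := by
  have zero : p 0 := by simpa using base 0
  refine induction_of t zero (fun i y => ?_) add
  induction i with
  | zero => exact base y
  | succ i ih =>
    refine btensor_induction (p := fun y => p (of R M (i + 1) y)) y ?_ ?_ ?_
    · exact (map_zero (of R M (i + 1))).symm ▸ zero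
    · exact fun m y => cons_of i m y ▸ cons m _ (ih y)
    · intro s t hs ht
      exact (map_add (of R M (i + 1)) s t).symm ▸ add _ _ hs ht

end TensorRing

variable {R M}
variable {X : Type u} [AddCommGroup X] [Module R X]

/-- The action `(m₁ ⊗ ⋯ ⊗ mᵢ ⊗ r) x = u (m₁ ⊗ u (m₂ ⊗ ⋯ u (mᵢ ⊗ r x)))` of `M^{⊗ i}` on `X`
that a linear map `u : M ⊗_R X → X` induces. -/
def powAct (u : BTensor R M X →ₗ[R] X) :
    (i : ℕ) → tensorPow R M i (ModuleCat.of R R) →ₗ[R] (X →+ X)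
  | 0 => LinearMap.toSpanSingleton R (X →+ X) (AddMonoidHom.id X)
  | i + 1 => btlift
      (fun m y => AddMonoidHom.mk' (fun x => u (btmul R m (powAct u i y x)))
        fun a b => by rw [map_add, btmul_add, map_add])
      (fun m n y => by ext x; simp [add_btmul])
      (fun m y z => by ext x; simp [btmul_add])
      (fun r m y => by ext x; simp [smul_btmul])
      (fun r m y => by ext x; simp [op_smul_btmul])

/-- The action of `T_R(M)` on `X` that a linear map `u : M ⊗_R X → X` induces. -/
def act (u : BTensor R M X →ₗ[R] X) : TensorRing R M →ₗ[R] (X →+ X) :=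
  DirectSum.toModule R ℕ (X →+ X) (powAct u)

theorem act_of (u : BTensor R M X →ₗ[R] X) (i : ℕ) (y : tensorPow R M i (ModuleCat.of R R)) :
    act u (TensorRing.of R M i y) = powAct u i y :=
  DirectSum.toModule_lof (M := fun i => tensorPow R M i (ModuleCat.of R R))
    (φ := powAct u) R i y

theorem act_base (u : BTensor R M X →ₗ[R] X) (r : R) (x : X) :
    act u (TensorRing.base R M r) x = r • x :=
  DFunLike.congr_fun (act_of u 0 r) x

theorem act_cons (u : BTensor R M X →ₗ[R] X) (m : M) (t : TensorRing R M) (x : X) :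
    act u (TensorRing.cons R M (btmul R m t)) x = u (btmul R m (act u t x)) := by
  induction t using TensorRing.induction_of with
  | zero => simp [btmul_zero]
  | of i y =>
    rw [TensorRing.cons_of, act_of, act_of]
    rfl
  | add s t hs ht => simp [btmul_add, hs, ht]

instance : Mul (TensorRing R M) where
  mul s t := act (TensorRing.cons R M) s t

instance : One (TensorRing R M) where
  one := TensorRing.base R M 1

theorem mul_eq_act (s t : TensorRing R M) : s * t = act (TensorRing.cons R M) s t := rfl

theorem base_mul (r : R) (t : TensorRing R M) : TensorRing.base R M r * t = r • t :=
  act_base _ r t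

theorem cons_mul (m : M) (s t : TensorRing R M) :
    TensorRing.cons R M (btmul R m s) * t = TensorRing.cons R M (btmul R m (s * t)) :=
  act_cons _ m s t

theorem act_one (u : BTensor R M X →ₗ[R] X) (x : X) : act u 1 x = x :=
  (act_base u 1 x).trans (one_smul R x)

theorem act_mul (u : BTensor R M X →ₗ[R] X) (s t : TensorRing R M) (x : X) :
    act u (s * t) x = act u s (act u t x) := by
  induction s using TensorRing.induction with
  | base r => simp [base_mul, act_base]
  | cons m s ih => rw [cons_mul, act_cons, act_cons, ih]
  | add a b ha hb =>
    rw [mul_eq_act] at ha hb ⊢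
    simp [ha, hb]

theorem tensorRing_mul_one (s : TensorRing R M) : s * 1 = s := by
  induction s using TensorRing.induction with
  | base r =>
    rw [base_mul]
    exact (map_smul (TensorRing.base R M) r 1).symm.trans (by simp)
  | cons m s ih => rw [cons_mul, ih]
  | add a b ha hb =>
    rw [mul_eq_act] at ha hb ⊢
    simp [ha, hb]

/-- The tensor ring `T_R(M)`, with `(m₁ ⊗ ⋯ ⊗ mᵢ) (n₁ ⊗ ⋯ ⊗ nⱼ) = m₁ ⊗ ⋯ ⊗ mᵢ ⊗ n₁ ⊗ ⋯ ⊗ nⱼ`. -/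
instance : Ring (TensorRing R M) :=
  { (inferInstance : AddCommGroup (TensorRing R M)),
    (inferInstance : Mul (TensorRing R M)), (inferInstance : One (TensorRing R M)) with
    mul_assoc := fun a b c => act_mul (TensorRing.cons R M) a b c
    one_mul := fun a => act_one (TensorRing.cons R M) a
    mul_one := tensorRing_mul_one
    left_distrib := fun a b c => map_add (act (TensorRing.cons R M) a) b c
    right_distrib := fun a b c => by simp [mul_eq_act]
    zero_mul := fun a => by simp [mul_eq_act]
    mul_zero := fun a => by simp [mul_eq_act] }

variable (R M)

/-- The inclusion of `R = M^{⊗ 0}` in `T_R(M)`. -/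
def baseHom : R →+* TensorRing R M where
  toFun r := TensorRing.base R M r
  map_one' := rfl
  map_mul' r s := (map_smul (TensorRing.base R M) r s).trans (base_mul r _).symm
  map_zero' := map_zero _
  map_add' := map_add _

/-- The inclusion of `M = M^{⊗ 1}` in `T_R(M)`. -/
def bimoduleIncl (m : M) : TensorRing R M := TensorRing.cons R M (btmul R m 1)

theorem bimoduleIncl_add (m n : M) :
    bimoduleIncl R M (m + n) = bimoduleIncl R M m + bimoduleIncl R M n := by
  simp [bimoduleIncl, add_btmul]

theorem bimoduleIncl_smul (r : R) (m : M) :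
    bimoduleIncl R M (r • m) = baseHom R M r * bimoduleIncl R M m := by
  rw [bimoduleIncl, smul_btmul, map_smul]
  exact (base_mul r _).symm

theorem bimoduleIncl_op_smul (r : R) (m : M) :
    bimoduleIncl R M (op r • m) = bimoduleIncl R M m * baseHom R M r := by
  rw [bimoduleIncl, bimoduleIncl, cons_mul, one_mul, op_smul_btmul, ← base_mul, mul_one]
  rfl

variable {R M}

/-- The ring homomorphism `T_R(M) → End_ℤ(X)` that a linear map `u : M ⊗_R X → X` induces. -/
def actHom (u : BTensor R M X →ₗ[R] X) : TensorRing R M →+* AddMonoid.End X where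
  toFun t := act u t
  map_one' := by ext x; exact act_one u x
  map_mul' s t := by ext x; exact act_mul u s t x
  map_zero' := map_zero (act u)
  map_add' := map_add (act u)

/-- The `T_R(M)`-module that corresponds to the pair `(X, u)`. -/
def ofPair (u : BTensor R M X →ₗ[R] X) : ModuleCat.{u} (TensorRing R M) :=
  letI : Module (TensorRing R M) X := Module.compHom X (actHom u)
  ModuleCat.of (TensorRing R M) X

variable (R M)

/-- The functor `Ind` on objects: the `T_R(M)`-module `(⨁ i, M^{⊗ i} ⊗_R X, c_X)`. -/
def Ind (X : ModuleCat.{u} R) : ModuleCat.{u} (TensorRing R M) :=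
  ofPair (indMap R M X)

/-- The forgetful functor from `T_R(M)`-modules to `R`-modules. -/
abbrev forgetToBase : ModuleCat.{u} (TensorRing R M) ⥤ ModuleCat.{u} R :=
  ModuleCat.restrictScalars (baseHom R M)

/-- The map `u : M ⊗_R X → X`, `m ⊗ x ↦ m x`, of the pair `(X, u)` that corresponds to a
`T_R(M)`-module `X`. -/
def structureMap (X : ModuleCat.{u} (TensorRing R M)) :
    BTensor R M ((forgetToBase R M).obj X) →ₗ[R] (forgetToBase R M).obj X :=
  btlift (X := (forgetToBase R M).obj X)
    (fun m x => (show (forgetToBase R M).obj X from bimoduleIncl R M m • (show X from x)))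
    (fun m n x => (congrArg (· • (show X from x)) (bimoduleIncl_add R M m n)).trans
      (add_smul _ _ (show X from x)))
    (fun m x y => smul_add (bimoduleIncl R M m) (show X from x) (show X from y))
    (fun r m x => (congrArg (· • (show X from x)) (bimoduleIncl_smul R M r m)).trans
      (mul_smul _ _ (show X from x)))
    (fun r m x => (congrArg (· • (show X from x)) (bimoduleIncl_op_smul R M r m)).trans
      (mul_smul _ _ (show X from x)))

/-- `Φ(𝒳)`: the `T_R(M)`-modules `(X, u)` with `u` injective and cokernel of `u` in `𝒳`. -/
def Phi (P : ObjectProperty (ModuleCat.{u} R)) :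
    ObjectProperty (ModuleCat.{u} (TensorRing R M)) := fun X =>
  Function.Injective (structureMap R M X) ∧
    P (ModuleCat.of R ((forgetToBase R M).obj X ⧸ LinearMap.range (structureMap R M X)))

end TensorRing

section Gorenstein

variable (A : Type u) [Ring A]

/-- Complete projective resolutions: exact sequences of projective modules that remain exact
under `Hom_A(-, P)` for every projective module `P`. -/
structure CompleteProjectiveResolution where
  X : ℤ → ModuleCat.{u} A
  d : ∀ i, X i →ₗ[A] X (i + 1)
  projective : ∀ i, Module.Projective A (X i)
  exact : ∀ i, Function.Exact (d i) (d (i + 1))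
  hom_exact : ∀ P : ModuleCat.{u} A, Module.Projective A P → ∀ i,
    Function.Exact (fun f : X (i + 1 + 1) →ₗ[A] P => f ∘ₗ d (i + 1))
      (fun f : X (i + 1) →ₗ[A] P => f ∘ₗ d i)

/-- The Gorenstein projective modules. -/
def GP : ObjectProperty (ModuleCat.{u} A) := fun G =>
  ∃ Q : CompleteProjectiveResolution A, Nonempty (G ≃ₗ[A] LinearMap.ker (Q.d 0))

end Gorenstein

section Conditions

variable (R : Type u) [Ring R]
variable (M : Type u) [AddCommGroup M] [Module R M] [Module Rᵐᵒᵖ M]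
variable (B : Type u) [AddCommGroup B] [Module R B] [Module Rᵐᵒᵖ B]

/-- The `R`-bimodule `B` is compatible (relative to the tensor ring `T_R(M)`): for every complete
projective resolution `Q` of `T_R(M)`-modules, `B ⊗_R Q` is exact, and `Hom(Q, Ind(B ⊗_R P))` is
exact for every projective `R`-module `P`. -/
def IsCompatible : Prop :=
  ∀ Q : CompleteProjectiveResolution (TensorRing R M),
    (∀ i, Function.Exact
      (btmap R B ((forgetToBase R M).map (ModuleCat.ofHom (Q.d i))).hom)
      (btmap R B ((forgetToBase R M).map (ModuleCat.ofHom (Q.d (i + 1)))).hom)) ∧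
    ∀ P : ModuleCat.{u} R, Module.Projective R P → ∀ i,
      Function.Exact
        (fun f : Q.X (i + 1 + 1) →ₗ[TensorRing R M] Ind R M (ModuleCat.of R (BTensor R B P)) =>
          f ∘ₗ Q.d (i + 1))
        (fun f : Q.X (i + 1) →ₗ[TensorRing R M] Ind R M (ModuleCat.of R (BTensor R B P)) =>
          f ∘ₗ Q.d i)

/-- The `R`-bimodule `B` is admissible: `Ext¹_R(G, B^{⊗ i} ⊗_R P) = 0 = Tor₁^R(B, B^{⊗ i} ⊗_R G)`
for all Gorenstein projective `G`, projective `P` and `i ≥ 0`. -/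
def IsAdmissible : Prop :=
  ∀ G : ModuleCat.{u} R, GP R G → ∀ P : ModuleCat.{u} R, Module.Projective R P → ∀ i : ℕ,
    Subsingleton (Abelian.Ext G (tensorPow R B i P) 1) ∧
      Subsingleton (Tor R B 1 (tensorPow R B i G))

end Conditions

end TensorRingGP

end

/-! Write T for T_R(M) and C(X) = X/MX for the cokernel of u. The link between R and T is the
functor Ind: it is left adjoint to restriction, so it preserves projectives; every projective
T-module is a summand of some Ind(P) with P projective; c_X is injective with cokernel X. There is
also a short exact sequence 0 → Ind(M ⊗ X) → Ind(X) → X → 0 of T-modules, where M acts as zero on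
the last term.

From GP(T) to Φ: let X be a kernel in a complete projective resolution Q. The structure maps of the
projectives in Q are injective, so (C1) makes C(Q) an exact complex of projectives, makes u
injective on X, and makes C(X) a kernel in C(Q). Moreover Hom_R(C(Q), P) = Hom_T(Q, P) with M acting
as zero on P, and the sequence above reduces its exactness to (C2) and to Hom(Q, Ind(P))
(`hom_trivMod_exact`, `mulMap_injective_and_gp_cok`).

From Φ to GP(T): it suffices to continue each X in Φ in both directions by short exact sequences
with middle term Ind(P), other end again in Φ, and exact under Hom into projectives (`gp_of_steps`).
The end terms come from sequences 0 → G → P → C(X) → 0 and 0 → C(X) → P → G → 0 over R with G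
Gorenstein projective (`exists_cover`, `exists_embedding`). Exactness under Hom is Ext¹_T(X, Q) = 0
for X in Φ and Q projective (`extVanish_projective`). Nilpotency enters through descending
inductions on the tensor degree: in degree N + 1 everything vanishes, and the sequences 0 → M ⊗ X →
X → C(X) → 0 and 0 → Ind(M ⊗ Y) → Ind(Y) → Y → 0 carry Ext and Tor vanishing, and injectivity, down
one degree. -/

noncomputable section

namespace TensorRingGP

section LinearAlgebra

variable {A : Type*} [Ring A] {L E Y : Type*} [AddCommGroup L] [Module A L]
  [AddCommGroup E] [Module A E] [AddCommGroup Y] [Module A Y]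

theorem exists_desc (p : L →ₗ[A] E) (hp : Function.Surjective p) (h : L →ₗ[A] Y)
    (hk : ∀ x, p x = 0 → h x = 0) : ∃ h' : E →ₗ[A] Y, ∀ x, h' (p x) = h x := by
  refine ⟨((LinearMap.ker p).liftQ h hk) ∘ₗ (p.quotKerEquivOfSurjective hp).symm.toLinearMap,
    fun x => ?_⟩
  have : (p.quotKerEquivOfSurjective hp).symm (p x) = (LinearMap.ker p).mkQ x := by
    rw [LinearEquiv.symm_apply_eq]; rfl
  rw [LinearMap.comp_apply, LinearEquiv.coe_coe, this]
  exact Submodule.liftQ_apply _ _ _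

theorem exists_factor (i : E →ₗ[A] L) (hi : Function.Injective i) (h : Y →ₗ[A] L)
    (hk : ∀ y, ∃ x, i x = h y) : ∃ h' : Y →ₗ[A] E, ∀ y, i (h' y) = h y := by
  refine ⟨(LinearEquiv.ofInjective i hi).symm.toLinearMap ∘ₗ
    h.codRestrict (LinearMap.range i) hk, fun y => ?_⟩
  rw [LinearMap.comp_apply, LinearEquiv.coe_coe, LinearEquiv.ofInjective_symm_apply]
  rfl

end LinearAlgebra

/-! ### Right exactness of M ⊗_R - and vanishing of Tor₁ -/

section BalancedTensor

variable (R : Type u) [Ring R]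
variable (M : Type u) [AddCommGroup M] [Module R M] [Module Rᵐᵒᵖ M]
variable {X Y Z K L : Type u} [AddCommGroup X] [Module R X] [AddCommGroup Y] [Module R Y]
  [AddCommGroup Z] [Module R Z] [AddCommGroup K] [Module R K] [AddCommGroup L] [Module R L]

variable {R M} in
theorem btensor_hom_ext {W : Type*} [AddCommGroup W] [Module R W] {f g : BTensor R M X →ₗ[R] W}
    (h : ∀ m x, f (btmul R m x) = g (btmul R m x)) : f = g := by
  ext t
  induction t using btensor_induction with
  | zero => simp
  | tmul m x => exact h m x
  | add s t hs ht => rw [map_add, map_add, hs, ht]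

theorem btmap_btmap (g : Y →ₗ[R] Z) (f : X →ₗ[R] Y) (t : BTensor R M X) :
    btmap R M g (btmap R M f t) = btmap R M (g ∘ₗ f) t :=
  LinearMap.congr_fun (f := btmap R M g ∘ₗ btmap R M f) (g := btmap R M (g ∘ₗ f))
    (btensor_hom_ext fun _ _ => rfl) t

theorem btmap_id (t : BTensor R M X) : btmap R M (LinearMap.id : X →ₗ[R] X) t = t :=
  LinearMap.congr_fun (f := btmap R M LinearMap.id) (g := LinearMap.id)
    (btensor_hom_ext fun _ _ => rfl) t

theorem btmap_zero (t : BTensor R M X) : btmap R M (0 : X →ₗ[R] Y) t = 0 :=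
  LinearMap.congr_fun (f := btmap R M 0) (g := 0)
    (btensor_hom_ext fun _ _ => btmul_zero R _) t

theorem btmap_eq_zero (f : X →ₗ[R] Y) (hf : ∀ x, f x = 0) (t : BTensor R M X) :
    btmap R M f t = 0 := by
  obtain rfl : f = 0 := LinearMap.ext hf
  exact btmap_zero R M t

theorem btmap_leftInverse (g : Y →ₗ[R] X) (f : X →ₗ[R] Y) (h : ∀ x, g (f x) = x)
    (t : BTensor R M X) : btmap R M g (btmap R M f t) = t := by
  rw [btmap_btmap, show g ∘ₗ f = LinearMap.id from LinearMap.ext h, btmap_id]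

theorem btmap_surjective (f : X →ₗ[R] Y) (hf : Function.Surjective f) :
    Function.Surjective (btmap R M f) := by
  intro t
  induction t using btensor_induction with
  | zero => exact ⟨0, map_zero _⟩
  | tmul m y => obtain ⟨x, rfl⟩ := hf y; exact ⟨btmul R m x, rfl⟩
  | add s t hs ht =>
    obtain ⟨a, rfl⟩ := hs
    obtain ⟨b, rfl⟩ := ht
    exact ⟨a + b, map_add _ _ _⟩

/-- `M ⊗_R -` is right exact. -/
theorem btmap_exact (f : X →ₗ[R] Y) (g : Y →ₗ[R] Z) (h : Function.Exact f g)
    (hg : Function.Surjective g) : Function.Exact (btmap R M f) (btmap R M g) := by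
  -- The inverse of (M ⊗ Y)/im → M ⊗ Z sends m ⊗ z to the class of m ⊗ y for any y over z.
  -- Independence of y is what lets the non-additive section `s` define a linear map.
  have key : ∀ (m : M) (y y' : Y), g y = g y' →
      (LinearMap.range (btmap R M f)).mkQ (btmul R m y) =
        (LinearMap.range (btmap R M f)).mkQ (btmul R m y') := by
    intro m y y' e
    obtain ⟨x, hx⟩ := (h (y - y')).1 (by rw [map_sub, e, sub_self])
    refine (Submodule.Quotient.eq _).2 ⟨btmul R m x, ?_⟩
    rw [btmap_btmul, hx, eq_sub_iff_add_eq, ← btmul_add, sub_add_cancel]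
  let s := Function.surjInv hg
  have hs : ∀ z, g (s z) = z := Function.surjInv_eq hg
  let inv : BTensor R M Z →ₗ[R] (BTensor R M Y ⧸ LinearMap.range (btmap R M f)) :=
    btlift (fun m z => (LinearMap.range (btmap R M f)).mkQ (btmul R m (s z)))
      (fun m n z => by rw [add_btmul, map_add])
      (fun m z w => by
        rw [← map_add, ← btmul_add]
        exact key _ _ _ (by simp [hs]))
      (fun r m z => by rw [smul_btmul, map_smul])
      (fun r m z => by
        rw [op_smul_btmul]
        exact key _ _ _ (by simp [hs]))
  intro t
  constructor
  · intro ht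
    have e : inv ∘ₗ btmap R M g = (LinearMap.range (btmap R M f)).mkQ :=
      btensor_hom_ext fun m y => key _ _ _ (hs _)
    have := LinearMap.congr_fun e t
    rw [LinearMap.comp_apply, ht, map_zero] at this
    exact (Submodule.Quotient.mk_eq_zero _).1 this.symm
  · rintro ⟨x, rfl⟩
    rw [btmap_btmap]
    exact btmap_eq_zero R M _ h.apply_apply_eq_zero x

/-- `Tor₁^R(M, X) = 0`, expressed by short exact sequences that end in `X`. -/
def TorVanish (X : Type u) [AddCommGroup X] [Module R X] : Prop :=
  ∀ (K L : Type u) [AddCommGroup K] [Module R K] [AddCommGroup L] [Module R L]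
    (i : K →ₗ[R] L) (p : L →ₗ[R] X), Function.Injective i → Function.Exact i p →
    Function.Surjective p → Function.Injective (btmap R M i)

/-- If one projective presentation of `X` stays injective under `M ⊗_R -`, then
`Tor₁^R(M, X) = 0`. -/
theorem torVanish_of_projective {K₀ P : Type u} [AddCommGroup K₀] [Module R K₀]
    [AddCommGroup P] [Module R P] [Module.Projective R P] (i₀ : K₀ →ₗ[R] P) (p₀ : P →ₗ[R] X)
    (h₀ : Function.Exact i₀ p₀) (hp₀ : Function.Surjective p₀)
    (hM : Function.Injective (btmap R M i₀)) : TorVanish R M X := by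
  intro K L _ _ _ _ i p hi h hp
  obtain ⟨φ, hφ⟩ := Module.projective_lifting_property p p₀ hp
  have hφ' : ∀ x, p (φ x) = p₀ x := fun x => LinearMap.congr_fun hφ x
  obtain ⟨ψ, hψ⟩ := exists_factor i hi (φ ∘ₗ i₀) fun k => (h _).1 (by
    rw [LinearMap.comp_apply, hφ', h₀.apply_apply_eq_zero])
  have hψ' : ∀ y, i (ψ y) = φ (i₀ y) := hψ
  rw [injective_iff_map_eq_zero]
  intro t ht
  -- Comparing the two presentations gives an exact sequence K₀ → P × K → L → 0, which M ⊗ -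
  -- preserves. If t dies in M ⊗ L, then (0, t) comes from some w in M ⊗ K₀; the P-component of (0,
  -- t) is zero and M ⊗ i₀ is injective, so w = 0 and t = 0.
  let κ : K₀ →ₗ[R] P × K := i₀.prod (-ψ)
  let σ : P × K →ₗ[R] L := φ.coprod i
  have hex : Function.Exact κ σ := by
    rintro ⟨x, k⟩
    constructor
    · intro e
      have e' : φ x + i k = 0 := by simpa [σ] using e
      obtain ⟨y, rfl⟩ := (h₀ x).1 (by
        rw [← hφ', eq_neg_of_add_eq_zero_left e', map_neg, h.apply_apply_eq_zero, neg_zero])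
      refine ⟨y, Prod.ext rfl (hi ?_)⟩
      change i (-ψ y) = i k
      rw [map_neg, hψ', neg_eq_iff_add_eq_zero, e']
    · rintro ⟨y, hy⟩
      rw [← hy]
      change φ (i₀ y) + i (-ψ y) = 0
      rw [map_neg, hψ', add_neg_cancel]
  have hsurj : Function.Surjective σ := by
    intro l
    obtain ⟨x, hx⟩ := hp₀ (p l)
    obtain ⟨k, hk⟩ := (h (l - φ x)).1 (by rw [map_sub, hφ', hx, sub_self])
    exact ⟨(x, k), by simp [σ, hk]⟩
  obtain ⟨w, hw⟩ := (btmap_exact R M κ σ hex hsurj (btmap R M (LinearMap.inr R P K) t)).1 (by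
    rw [btmap_btmap, show σ ∘ₗ LinearMap.inr R P K = i by ext; simp [σ], ht])
  have hw0 : w = 0 := by
    apply hM
    have := congrArg (btmap R M (LinearMap.fst R P K)) hw
    rw [btmap_btmap, btmap_btmap, show LinearMap.fst R P K ∘ₗ κ = i₀ from rfl] at this
    rw [this, map_zero]
    exact btmap_eq_zero R M _ (fun _ => rfl) t
  rw [← btmap_leftInverse R M (LinearMap.snd R P K) (LinearMap.inr R P K) (fun _ => rfl) t,
    ← hw, hw0, map_zero, map_zero]

/-- With P₂ → P₁ → P₀ → X the start of a projective resolution, an element of M ⊗ ker(P₀ → X) that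
dies in M ⊗ P₀ lifts to M ⊗ P₁, hence, by exactness there, to M ⊗ P₂; but P₂ → ker(P₀ → X) is zero.
-/
theorem torVanish_of_subsingleton_tor (X : ModuleCat.{u} R) (h : Subsingleton (Tor R M 1 X)) :
    TorVanish R M X := by
  let P := ProjectiveResolution.of X
  have hz : Limits.IsZero (Tor R M 1 X) := ModuleCat.isZero_of_subsingleton _
  have hexM : (((tensorFunctor R M).mapHomologicalComplex _).obj P.complex).ExactAt 1 := by
    rw [HomologicalComplex.exactAt_iff_isZero_homology]
    exact hz.of_iso (P.isoLeftDerivedObj (tensorFunctor R M) 1).symm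
  rw [HomologicalComplex.exactAt_iff' _ 2 1 0 (by simp) (by simp),
    ShortComplex.moduleCat_exact_iff] at hexM
  let p : P.complex.X 0 →ₗ[R] X := (P.π.f 0).hom
  have hdp : Function.Exact (P.complex.d 1 0).hom p :=
    (ShortComplex.ShortExact.moduleCat_exact_iff_function_exact _).1 P.exact₀
  have hp : Function.Surjective p :=
    (ModuleCat.epi_iff_surjective (P.π.f 0)).1 inferInstance
  have hproj : Module.Projective R (P.complex.X 0) :=
    (IsProjective.iff_projective _).2 (P.projective 0)
  refine torVanish_of_projective R M (LinearMap.ker p).subtype p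
    (LinearMap.exact_subtype_ker_map p) hp ?_
  let c : P.complex.X 1 →ₗ[R] LinearMap.ker p :=
    (P.complex.d 1 0).hom.codRestrict _ hdp.apply_apply_eq_zero
  have hc : Function.Surjective c := by
    rintro ⟨x, hx⟩
    obtain ⟨y, rfl⟩ := (hdp x).1 hx
    exact ⟨y, rfl⟩
  rw [injective_iff_map_eq_zero]
  intro t ht
  obtain ⟨t, rfl⟩ := btmap_surjective R M c hc t
  rw [btmap_btmap] at ht
  obtain ⟨s, hs⟩ : ∃ s : BTensor R M (P.complex.X 2), btmap R M (P.complex.d 2 1).hom s = t :=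
    hexM t ht
  rw [← hs, btmap_btmap]
  refine btmap_eq_zero R M _ (fun x => Subtype.ext ?_) s
  exact LinearMap.congr_fun (congrArg ModuleCat.Hom.hom (P.complex.d_comp_d 2 1 0)) x

/-- Let L' be the preimage of X in L. Then K → L → Y breaks into K → L' with cokernel X and L' → L
with cokernel Z, and both inclusions stay injective. -/
theorem TorVanish.of_exact {i : X →ₗ[R] Y} {p : Y →ₗ[R] Z} (hi : Function.Injective i)
    (h : Function.Exact i p) (hp : Function.Surjective p) (hX : TorVanish R M X)
    (hZ : TorVanish R M Z) : TorVanish R M Y := by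
  intro K L _ _ _ _ j q hj hjq hq
  let L' : Submodule R L := LinearMap.ker (p ∘ₗ q)
  obtain ⟨q', hq'⟩ := exists_factor i hi (q ∘ₗ L'.subtype) fun l => (h _).1 l.2
  have hj' : ∀ k, j k ∈ L' := fun k => by
    simp [L', hjq.apply_apply_eq_zero]
  have h1 : Function.Injective (btmap R M (j.codRestrict L' hj')) := by
    refine hX K L' _ q' (fun a b e => hj (congrArg Subtype.val e)) ?_ ?_
    · intro l
      constructor
      · intro e
        obtain ⟨k, hk⟩ := (hjq l).1 (by
          have := hq' l
          rw [e, map_zero] at this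
          exact this.symm)
        exact ⟨k, Subtype.ext hk⟩
      · rintro ⟨k, rfl⟩
        apply hi
        rw [hq', map_zero]
        exact hjq.apply_apply_eq_zero k
    · intro x
      obtain ⟨l, hl⟩ := hq (i x)
      refine ⟨⟨l, by simp [L', hl, h.apply_apply_eq_zero]⟩, hi ?_⟩
      rw [hq']
      exact hl
  have h2 : Function.Injective (btmap R M L'.subtype) :=
    hZ L' L _ (p ∘ₗ q) L'.subtype_injective (LinearMap.exact_subtype_ker_map _) (hp.comp hq)
  intro a b e
  apply h1
  apply h2
  rwa [btmap_btmap, btmap_btmap]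

theorem TorVanish.of_subsingleton [Subsingleton X] : TorVanish R M X := by
  intro K L _ _ _ _ i p hi h hp
  have hs : Function.Surjective i := fun l => (h l).1 (Subsingleton.elim _ _)
  let e := LinearEquiv.ofBijective i ⟨hi, hs⟩
  exact Function.LeftInverse.injective (g := btmap R M e.symm.toLinearMap)
    (btmap_leftInverse R M _ _ e.symm_apply_apply)

end BalancedTensor

/-! ### Vanishing of Ext¹ by extension of maps -/

section ExtVanish

variable (A : Type u) [Ring A]

theorem exists_projective_cover (E : Type u) [AddCommGroup E] [Module A E] :
    ∃ (L : Type u) (_ : AddCommGroup L) (_ : Module A L) (_ : Module.Projective A L)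
      (q : L →ₗ[A] E), Function.Surjective q :=
  ⟨E →₀ A, inferInstance, inferInstance, inferInstance, Finsupp.linearCombination A id,
    Finsupp.linearCombination_id_surjective A E⟩

/-- `Ext¹_A(X, Y) = 0`, expressed by projective presentations of `X`. -/
def ExtVanish (X Y : Type u) [AddCommGroup X] [Module A X] [AddCommGroup Y] [Module A Y] : Prop :=
  ∀ (K L : Type u) [AddCommGroup K] [Module A K] [AddCommGroup L] [Module A L]
    [Module.Projective A L] (i : K →ₗ[A] L) (p : L →ₗ[A] X), Function.Injective i →
    Function.Exact i p → Function.Surjective p → ∀ g : K →ₗ[A] Y, ∃ h : L →ₗ[A] Y,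
      ∀ k, h (i k) = g k

variable {A} {X Y Y' Y'' : Type u} [AddCommGroup X] [Module A X] [AddCommGroup Y] [Module A Y]
  [AddCommGroup Y'] [Module A Y'] [AddCommGroup Y''] [Module A Y'']

/-- This removes the projectivity of the middle term from `ExtVanish`: pull g back to the kernel of
L → E → X for a projective L over E, extend it to L, and descend to E, since the extension kills
ker(L → E). -/
theorem ExtVanish.extend (hXY : ExtVanish A X Y) {W E : Type u} [AddCommGroup W] [Module A W]
    [AddCommGroup E] [Module A E] {i : W →ₗ[A] E} {p : E →ₗ[A] X} (hi : Function.Injective i)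
    (hip : Function.Exact i p) (hp : Function.Surjective p) (g : W →ₗ[A] Y) :
    ∃ h : E →ₗ[A] Y, ∀ w, h (i w) = g w := by
  obtain ⟨L, _, _, _, q, hq⟩ := exists_projective_cover A E
  let K : Submodule A L := LinearMap.ker (p ∘ₗ q)
  have hK : ∀ k : K, ∃ w, i w = q.domRestrict K k := fun k => (hip (q k.1)).1 k.2
  obtain ⟨r, hr⟩ := exists_factor i hi (q.domRestrict K) hK
  obtain ⟨h, hh⟩ := hXY K L K.subtype (p ∘ₗ q) K.subtype_injective
    (LinearMap.exact_subtype_ker_map _) (hp.comp hq) (g ∘ₗ r)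
  obtain ⟨h', hh'⟩ := exists_desc q hq h fun x hx => by
    have hxK : x ∈ K := by simp [K, hx]
    have h1 := hh ⟨x, hxK⟩
    have h2 : r ⟨x, hxK⟩ = 0 := hi (by rw [hr, map_zero]; exact hx)
    rw [LinearMap.comp_apply, h2, map_zero] at h1
    exact h1
  refine ⟨h', fun w => ?_⟩
  obtain ⟨x, hx⟩ := hq (i w)
  have hxK : x ∈ K := by simp [K, hx, hip.apply_apply_eq_zero]
  have h1 := hh ⟨x, hxK⟩
  have h2 : r ⟨x, hxK⟩ = w := hi ((hr _).trans hx)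
  rw [LinearMap.comp_apply, h2] at h1
  rw [← hx, hh']
  exact h1

/-- Lift f to a map on a projective L over X. On ker(L → X) this lift takes values in Y'; extend
that restriction to L and subtract it, so that the difference descends to X. -/
theorem ExtVanish.lift {i : Y' →ₗ[A] Y} {p : Y →ₗ[A] Y''} (hi : Function.Injective i)
    (hip : Function.Exact i p) (hp : Function.Surjective p) (h' : ExtVanish A X Y')
    (f : X →ₗ[A] Y'') : ∃ f' : X →ₗ[A] Y, ∀ x, p (f' x) = f x := by
  obtain ⟨L, _, _, _, q, hq⟩ := exists_projective_cover A X
  obtain ⟨a, ha⟩ := Module.projective_lifting_property p (f ∘ₗ q) hp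
  have ha' : ∀ x, p (a x) = f (q x) := fun x => LinearMap.congr_fun ha x
  let K : Submodule A L := LinearMap.ker q
  have hK : ∀ k : K, ∃ w, i w = a.domRestrict K k := fun k => (hip (a k.1)).1 (by
    rw [ha', show q k.1 = 0 from k.2, map_zero])
  obtain ⟨r, hr⟩ := exists_factor i hi (a.domRestrict K) hK
  obtain ⟨h, hh⟩ := h' K L K.subtype q K.subtype_injective (LinearMap.exact_subtype_ker_map _)
    hq r
  obtain ⟨f', hf'⟩ := exists_desc q hq (a - i ∘ₗ h) fun x hx => by
    have h1 : h x = r ⟨x, hx⟩ := hh ⟨x, hx⟩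
    rw [LinearMap.sub_apply, LinearMap.comp_apply, h1, hr]
    exact sub_self _
  refine ⟨f', fun x => ?_⟩
  obtain ⟨y, rfl⟩ := hq x
  rw [hf', LinearMap.sub_apply, LinearMap.comp_apply, map_sub, ha', hip.apply_apply_eq_zero,
    sub_zero]

theorem ExtVanish.of_exact {i : Y' →ₗ[A] Y} {p : Y →ₗ[A] Y''} (hi : Function.Injective i)
    (hip : Function.Exact i p) (hp : Function.Surjective p) (h' : ExtVanish A X Y')
    (h'' : ExtVanish A X Y'') : ExtVanish A X Y := by
  intro K L _ _ _ _ _ j q hj hjq hq g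
  obtain ⟨a, ha⟩ := h'' K L j q hj hjq hq (p ∘ₗ g)
  obtain ⟨b, hb⟩ := Module.projective_lifting_property p a hp
  have hb' : ∀ x, p (b x) = a x := fun x => LinearMap.congr_fun hb x
  obtain ⟨c, hc⟩ := exists_factor i hi (g - b ∘ₗ j) fun k => (hip _).1 (by
    simp [hb', ha])
  obtain ⟨d, hd⟩ := h' K L j q hj hjq hq c
  refine ⟨b + i ∘ₗ d, fun k => ?_⟩
  simp [hd, hc]

theorem ExtVanish.of_subsingleton [Subsingleton Y] : ExtVanish A X Y :=
  fun _ _ _ _ _ _ _ _ _ _ _ _ _ => ⟨0, fun _ => Subsingleton.elim _ _⟩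

theorem ExtVanish.of_retract (hXY : ExtVanish A X Y) (s : Y' →ₗ[A] Y) (r : Y →ₗ[A] Y')
    (h : ∀ y, r (s y) = y) : ExtVanish A X Y' := by
  intro K L _ _ _ _ _ j q hj hjq hq g
  obtain ⟨a, ha⟩ := hXY K L j q hj hjq hq (s ∘ₗ g)
  exact ⟨r ∘ₗ a, fun k => by simp [ha, h]⟩

/-- The obstruction to extending g is its image under the connecting map Hom(K, Y) → Ext¹(X, Y). -/
theorem extVanish_of_subsingleton_ext (X Y : ModuleCat.{u} A)
    (h : Subsingleton (Abelian.Ext X Y 1)) : ExtVanish A X Y := by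
  intro K L _ _ _ _ _ i p hi hip hp g
  let S : ShortComplex (ModuleCat.{u} A) :=
    ShortComplex.mk (ModuleCat.ofHom i) (ModuleCat.ofHom p) (by
      ext x; exact hip.apply_apply_eq_zero x)
  have hS : S.ShortExact := by
    have : Mono S.f := (ModuleCat.mono_iff_injective _).2 hi
    have : Epi S.g := (ModuleCat.epi_iff_surjective _).2 hp
    exact { exact := (ShortComplex.ShortExact.moduleCat_exact_iff_function_exact _).2 hip }
  obtain ⟨x, hx⟩ := Abelian.Ext.contravariant_sequence_exact₁ hS Y
    (Abelian.Ext.mk₀ (ModuleCat.ofHom g : S.X₁ ⟶ Y)) (n₁ := 1) (by simp)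
    (Subsingleton.elim (α := Abelian.Ext X Y 1) _ _)
  obtain ⟨f, rfl⟩ := (Abelian.Ext.mk₀_bijective _ _).2 x
  rw [Abelian.Ext.mk₀_comp_mk₀] at hx
  have := (Abelian.Ext.mk₀_bijective _ _).1 hx
  exact ⟨f.hom, fun k => LinearMap.congr_fun (congrArg ModuleCat.Hom.hom this) k⟩

end ExtVanish

/-! ### Gorenstein projectives by splicing short exact sequences -/

section Gorenstein

theorem exists_int_sequence {α : Type*} (r : α → α → Prop) (hf : ∀ a, ∃ b, r a b)
    (hb : ∀ a, ∃ b, r b a) (a : α) : ∃ z : ℤ → α, z 0 = a ∧ ∀ i, r (z i) (z (i + 1)) := by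
  choose next hnext using hf
  choose prev hprev using hb
  refine ⟨fun | .ofNat n => next^[n] a | .negSucc n => prev^[n + 1] a, rfl, ?_⟩
  -- The cases are i ≥ 0, i = -1, where the two iterations meet at `a`, and i ≤ -2.
  rintro (n | _ | n)
  · change r (next^[n] a) (next^[n + 1] a)
    rw [Function.iterate_succ_apply']
    exact hnext _
  · exact hprev a
  · change r (prev^[n + 1 + 1] a) (prev^[n + 1] a)
    rw [Function.iterate_succ_apply' _ (n + 1)]
    exact hprev _

variable {A : Type u} [Ring A]

/-- There is a short exact sequence `0 → W → Q → W' → 0` with `Q` projective, such that every map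
from `W` to a projective module extends to `Q`. -/
def GPStep (W W' : ModuleCat.{u} A) : Prop :=
  ∃ (Q : ModuleCat.{u} A) (i : W →ₗ[A] Q) (p : Q →ₗ[A] W'), Module.Projective A Q ∧
    Function.Injective i ∧ Function.Exact i p ∧ Function.Surjective p ∧
    ∀ P : ModuleCat.{u} A, Module.Projective A P → ∀ g : W →ₗ[A] P,
      ∃ h : Q →ₗ[A] P, ∀ w, h (i w) = g w

/-- A class of modules in which `GPStep` can be continued in both directions consists of
Gorenstein projective modules. -/
theorem gp_of_steps (𝒲 : ObjectProperty (ModuleCat.{u} A))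
    (hf : ∀ W, 𝒲 W → ∃ W', 𝒲 W' ∧ GPStep W W') (hb : ∀ W, 𝒲 W → ∃ W', 𝒲 W' ∧ GPStep W' W)
    (G : ModuleCat.{u} A) (hG : 𝒲 G) : GP A G := by
  obtain ⟨z, hz0, hz⟩ := exists_int_sequence (α := {W // 𝒲 W}) (fun W W' => GPStep W.1 W'.1)
    (fun W => let ⟨W', h, h'⟩ := hf W.1 W.2; ⟨⟨W', h⟩, h'⟩)
    (fun W => let ⟨W', h, h'⟩ := hb W.1 W.2; ⟨⟨W', h⟩, h'⟩) ⟨G, hG⟩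
  choose Q i p hproj hi hip hp hext using hz
  have hd : ∀ n x, i (n + 1) (p n x) = 0 ↔ ∃ w, i n w = x := fun n x => by
    rw [map_eq_zero_iff _ (hi (n + 1))]
    exact hip n x
  refine ⟨{ X := Q, d := fun n => i (n + 1) ∘ₗ p n, projective := hproj,
            exact := ?_, hom_exact := ?_ }, ⟨?_⟩⟩
  · intro n x
    refine (hd (n + 1) x).trans ⟨?_, ?_⟩
    · rintro ⟨w, rfl⟩
      obtain ⟨y, rfl⟩ := hp n w
      exact ⟨y, rfl⟩
    · rintro ⟨y, rfl⟩
      exact ⟨p n y, rfl⟩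
  · intro P hP n f
    constructor
    · intro hf0
      -- A cocycle kills the kernel of `p (n + 1)`, so it descends to the next syzygy, from which it
      -- extends to the next projective.
      obtain ⟨f', hf'⟩ := exists_desc (p (n + 1)) (hp (n + 1)) f fun x hx => by
        obtain ⟨w, rfl⟩ := (hip (n + 1) x).1 hx
        obtain ⟨y, rfl⟩ := hp n w
        exact LinearMap.congr_fun hf0 y
      obtain ⟨h, hh⟩ := hext (n + 1 + 1) P hP f'
      refine ⟨h, LinearMap.ext fun x => ?_⟩
      change h (i (n + 1 + 1) (p (n + 1) x)) = f x
      rw [hh, hf']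
    · rintro ⟨h, rfl⟩
      refine LinearMap.ext fun x => ?_
      change h (i (n + 1 + 1) (p (n + 1) (i (n + 1) (p n x)))) = 0
      rw [(hip (n + 1)).apply_apply_eq_zero, map_zero, map_zero]
  · have hG0 : G = (z 0).1 := by rw [hz0]
    subst hG0
    refine (LinearEquiv.ofInjective (i 0) (hi 0)).trans (LinearEquiv.ofEq _ _ ?_)
    ext x
    exact (hd 0 x).symm

variable (A) in
/-- The modules that occur as kernels in complete projective resolutions. -/
def IsSyzygy : ObjectProperty (ModuleCat.{u} A) := fun G =>
  ∃ (Q : CompleteProjectiveResolution A) (j : ℤ) (i : G →ₗ[A] Q.X j), Function.Injective i ∧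
    Function.Exact i (Q.d j)

theorem isSyzygy_of_gp {G : ModuleCat.{u} A} (h : GP A G) : IsSyzygy A G := by
  obtain ⟨Q, ⟨e⟩⟩ := h
  refine ⟨Q, 0, (LinearMap.ker (Q.d 0)).subtype ∘ₗ e.toLinearMap,
    Subtype.val_injective.comp e.injective, fun x => ?_⟩
  constructor
  · intro hx
    exact ⟨e.symm ⟨x, hx⟩, by simp⟩
  · rintro ⟨y, rfl⟩
    exact (e y).2

theorem CompleteProjectiveResolution.step (Q : CompleteProjectiveResolution A) (j : ℤ)
    {W W' : ModuleCat.{u} A} (i : W →ₗ[A] Q.X j) (hi : Function.Injective i)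
    (hid : Function.Exact i (Q.d j)) (i' : W' →ₗ[A] Q.X (j + 1)) (hi' : Function.Injective i')
    (hid' : Function.Exact i' (Q.d (j + 1))) : GPStep W W' := by
  obtain ⟨p, hp⟩ := exists_factor i' hi' (Q.d j) fun y => (hid' _).1 ((Q.exact j _).2 ⟨y, rfl⟩)
  refine ⟨Q.X j, i, p, Q.projective j, hi, ?_, ?_, ?_⟩
  · intro x
    rw [← hid x, ← hp, map_eq_zero_iff _ hi']
  · intro w
    obtain ⟨x, hx⟩ := (Q.exact j _).1 (hid'.apply_apply_eq_zero w)
    exact ⟨x, hi' (by rw [hp, hx])⟩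
  · intro P hP g
    -- W is also the image of the preceding differential, so g pulls back to a cocycle on `Q.X (k +
    -- 1)`. Writing it as a coboundary gives the extension of g to `Q.X j`.
    obtain ⟨k, rfl⟩ : ∃ k, j = k + 1 + 1 := ⟨j - 2, by omega⟩
    obtain ⟨q, hq⟩ := exists_factor i hi (Q.d (k + 1)) fun y =>
      (hid _).1 ((Q.exact (k + 1) _).2 ⟨y, rfl⟩)
    obtain ⟨h, hh⟩ := (Q.hom_exact P hP k (g ∘ₗ q)).1 (LinearMap.ext fun x => by
      change g (q (Q.d k x)) = 0
      rw [show q (Q.d k x) = 0 from hi (by rw [hq, map_zero]; exact (Q.exact k _).2 ⟨x, rfl⟩),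
        map_zero])
    refine ⟨h, fun w => ?_⟩
    obtain ⟨x, hx⟩ := (Q.exact (k + 1) _).1 (hid.apply_apply_eq_zero w)
    have hw : q x = w := hi (by rw [hq, hx])
    rw [← hx, ← hw]
    exact LinearMap.congr_fun hh x

theorem IsSyzygy.exists_next {G : ModuleCat.{u} A} (h : IsSyzygy A G) :
    ∃ G', IsSyzygy A G' ∧ GPStep G G' := by
  obtain ⟨Q, j, i, hi, hid⟩ := h
  have h1 := (LinearMap.ker (Q.d (j + 1))).subtype_injective
  have h2 := LinearMap.exact_subtype_ker_map (Q.d (j + 1))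
  exact ⟨ModuleCat.of A (LinearMap.ker (Q.d (j + 1))), ⟨Q, j + 1, _, h1, h2⟩,
    Q.step j i hi hid _ h1 h2⟩

theorem IsSyzygy.exists_prev {G : ModuleCat.{u} A} (h : IsSyzygy A G) :
    ∃ G', IsSyzygy A G' ∧ GPStep G' G := by
  obtain ⟨Q, j, i, hi, hid⟩ := h
  obtain ⟨k, rfl⟩ : ∃ k, j = k + 1 := ⟨j - 1, by omega⟩
  have h1 := (LinearMap.ker (Q.d k)).subtype_injective
  have h2 := LinearMap.exact_subtype_ker_map (Q.d k)
  exact ⟨ModuleCat.of A (LinearMap.ker (Q.d k)), ⟨Q, k, _, h1, h2⟩,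
    Q.step k _ h1 h2 i hi hid⟩

theorem IsSyzygy.gp {G : ModuleCat.{u} A} (h : IsSyzygy A G) : GP A G :=
  gp_of_steps (IsSyzygy A) (fun _ h => h.exists_next) (fun _ h => h.exists_prev) G h

theorem GP.exists_next {G : ModuleCat.{u} A} (h : GP A G) : ∃ G', GP A G' ∧ GPStep G G' :=
  let ⟨G', h', hs⟩ := (isSyzygy_of_gp h).exists_next; ⟨G', h'.gp, hs⟩

theorem GP.exists_prev {G : ModuleCat.{u} A} (h : GP A G) : ∃ G', GP A G' ∧ GPStep G' G :=
  let ⟨G', h', hs⟩ := (isSyzygy_of_gp h).exists_prev; ⟨G', h'.gp, hs⟩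

theorem GP.of_equiv {G G' : ModuleCat.{u} A} (h : GP A G) (e : G ≃ₗ[A] G') : GP A G' :=
  let ⟨Q, ⟨e'⟩⟩ := h; ⟨Q, ⟨e.symm.trans e'⟩⟩

end Gorenstein

/-! ### Tensor powers and nilpotency -/

section TensorPowers

variable (R : Type u) [Ring R]
variable (M : Type u) [AddCommGroup M] [Module R M] [Module Rᵐᵒᵖ M]

/-- `M ⊗ e` for a linear equivalence `e`. -/
def btcongr {X Y : Type u} [AddCommGroup X] [Module R X] [AddCommGroup Y] [Module R Y]
    (e : X ≃ₗ[R] Y) : BTensor R M X ≃ₗ[R] BTensor R M Y :=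
  { btmap R M e.toLinearMap with
    invFun := btmap R M e.symm.toLinearMap
    left_inv := btmap_leftInverse R M e.symm.toLinearMap e.toLinearMap e.symm_apply_apply
    right_inv := btmap_leftInverse R M e.toLinearMap e.symm.toLinearMap e.apply_symm_apply }

/-- `M^{⊗ i} ⊗_R f`. -/
def tpmap {X Y : ModuleCat.{u} R} (f : X →ₗ[R] Y) :
    (i : ℕ) → tensorPow R M i X →ₗ[R] tensorPow R M i Y
  | 0 => f
  | i + 1 => btmap R M (tpmap f i)

/-- `M^{⊗ i} ⊗_R (M ⊗_R X) ≅ M^{⊗ (i + 1)} ⊗_R X`. -/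
def tensorPowSucc (X : ModuleCat.{u} R) : (i : ℕ) →
    tensorPow R M i (ModuleCat.of R (BTensor R M X)) ≃ₗ[R] tensorPow R M (i + 1) X
  | 0 => LinearEquiv.refl R _
  | i + 1 => btcongr R M (tensorPowSucc X i)

theorem tensorPow_subsingleton {i : ℕ} (h : Subsingleton (tensorPow R M i (ModuleCat.of R R)))
    (X : ModuleCat.{u} R) : Subsingleton (tensorPow R M i X) := by
  let s (x : X) : ModuleCat.of R R →ₗ[R] X := LinearMap.toSpanSingleton R X x
  -- Nilpotency concerns M^{⊗ i} ⊗ R only. It passes to X because M^{⊗ i} ⊗ X is spanned by the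
  -- images of M^{⊗ i} ⊗ R under the maps r ↦ r x.
  have key : ∀ (j : ℕ) (y : tensorPow R M j X), y ∈ ⨆ x, LinearMap.range (tpmap R M (s x) j) := by
    intro j
    induction j with
    | zero =>
      intro y
      exact Submodule.mem_iSup_of_mem y ⟨(1 : R), one_smul R (y : X)⟩
    | succ j ih =>
      intro y
      refine btensor_induction (R := R) (M := M) (X := tensorPow R M j X)
        (p := fun y : tensorPow R M (j + 1) X =>
          y ∈ ⨆ x, LinearMap.range (tpmap R M (s x) (j + 1))) y
        (zero_mem _) (fun m y => ?_) (fun _ _ => add_mem)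
      induction ih y using Submodule.iSup_induction' with
      | mem x y hy =>
        obtain ⟨z, rfl⟩ := hy
        exact Submodule.mem_iSup_of_mem x ⟨consTensor R M j m z, rfl⟩
      | zero => rw [btmul_zero]; exact zero_mem _
      | add y z _ _ hy hz => rw [btmul_add]; exact add_mem hy hz
  have hbot : ∀ y : tensorPow R M i X, y = 0 := fun y => by
    have := key i y
    rw [(iSup_eq_bot.2 fun x => ?_), Submodule.mem_bot] at this
    · exact this
    · rw [LinearMap.range_eq_bot]
      ext z
      rw [Subsingleton.elim z 0, map_zero, map_zero]
  exact ⟨fun a b => by rw [hbot a, hbot b]⟩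

theorem tensorPow_subsingleton_of_le {i j : ℕ} (hij : i ≤ j) (X : ModuleCat.{u} R)
    (h : Subsingleton (tensorPow R M i X)) : Subsingleton (tensorPow R M j X) := by
  induction j, hij using Nat.le_induction with
  | base => exact h
  | succ j _ ih =>
    refine ⟨fun a b => ?_⟩
    have : ∀ y : tensorPow R M (j + 1) X, y = 0 := fun y => by
      refine btensor_induction (p := fun y => y = 0) y rfl (fun m z => ?_) ?_
      · rw [Subsingleton.elim z 0, btmul_zero]
      · rintro _ _ rfl rfl; exact add_zero _
    rw [this a, this b]

theorem TorVanish.of_equiv {X Y : Type u} [AddCommGroup X] [Module R X] [AddCommGroup Y]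
    [Module R Y] (h : TorVanish R M X) (e : X ≃ₗ[R] Y) : TorVanish R M Y :=
  fun K L _ _ _ _ i p hi hip hp => h K L i (e.symm.toLinearMap ∘ₗ p) hi
    (fun x => by simpa using hip x) (e.symm.surjective.comp hp)

/-- A short exact sequence stays exact under `M^{⊗ i} ⊗_R -` if the relevant `Tor₁` vanish. -/
theorem tpmap_exact {X Y Z : ModuleCat.{u} R} {f : X →ₗ[R] Y} {g : Y →ₗ[R] Z}
    (hf : Function.Injective f) (hfg : Function.Exact f g) (hg : Function.Surjective g)
    (hZ : ∀ i, TorVanish R M (tensorPow R M i Z)) (i : ℕ) :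
    Function.Injective (tpmap R M f i) ∧ Function.Exact (tpmap R M f i) (tpmap R M g i) ∧
      Function.Surjective (tpmap R M g i) := by
  induction i with
  | zero => exact ⟨hf, hfg, hg⟩
  | succ i ih =>
    obtain ⟨h1, h2, h3⟩ := ih
    exact ⟨hZ i _ _ _ _ h1 h2 h3, btmap_exact R M _ _ h2 h3, btmap_surjective R M _ h3⟩

end TensorPowers

/-! ### T_R(M)-modules as pairs (X, u) -/

section TensorRingModules

variable (R : Type u) [Ring R]
variable (M : Type u) [AddCommGroup M] [Module R M] [Module Rᵐᵒᵖ M]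

instance : IsScalarTower R (TensorRing R M) (TensorRing R M) where
  smul_assoc r s t := by
    rw [smul_eq_mul, smul_eq_mul, ← base_mul, ← base_mul, mul_assoc]

theorem cons_eq_mul (m : M) (t : TensorRing R M) :
    TensorRing.cons R M (btmul R m t) = bimoduleIncl R M m * t := by
  rw [bimoduleIncl, cons_mul, one_mul]

variable {X Y : Type u} [AddCommGroup X] [Module R X] [Module (TensorRing R M) X]
  [IsScalarTower R (TensorRing R M) X] [AddCommGroup Y] [Module R Y] [Module (TensorRing R M) Y]
  [IsScalarTower R (TensorRing R M) Y]

theorem baseHom_smul (r : R) (x : X) : baseHom R M r • x = r • x := by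
  have h : baseHom R M r = r • (1 : TensorRing R M) := (mul_one _).symm.trans (base_mul r 1)
  rw [h, smul_assoc, one_smul]

variable (X) in
/-- The map `M ⊗_R X → X`, `m ⊗ x ↦ m x`, of a `T_R(M)`-module `X`. -/
def mulMap : BTensor R M X →ₗ[R] X :=
  btlift (fun m x => bimoduleIncl R M m • x)
    (fun m n x => by rw [bimoduleIncl_add, add_smul])
    (fun m x y => smul_add _ _ _)
    (fun r m x => by rw [bimoduleIncl_smul, mul_smul, baseHom_smul])
    (fun r m x => by rw [bimoduleIncl_op_smul, mul_smul, baseHom_smul])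

theorem map_mulMap (f : X →ₗ[TensorRing R M] Y) (t : BTensor R M X) :
    f (mulMap R M X t) = mulMap R M Y (btmap R M (f.restrictScalars R) t) :=
  LinearMap.congr_fun (f := f.restrictScalars R ∘ₗ mulMap R M X)
    (g := mulMap R M Y ∘ₗ btmap R M (f.restrictScalars R))
    (btensor_hom_ext fun m x => map_smul f (bimoduleIncl R M m) x) t

variable {R M} in
/-- An `R`-linear map that commutes with the structure maps is `T_R(M)`-linear. -/
def homOfCommute (f : X →ₗ[R] Y)
    (h : ∀ m x, f (bimoduleIncl R M m • x) = bimoduleIncl R M m • f x) :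
    X →ₗ[TensorRing R M] Y where
  toFun := f
  map_add' := map_add f
  map_smul' t x := by
    induction t using TensorRing.induction with
    | base r =>
      refine (congrArg f (baseHom_smul R M r x)).trans ?_
      rw [map_smul]
      exact (baseHom_smul R M r (f x)).symm
    | cons m t ih =>
      rw [RingHom.id_apply] at ih ⊢
      rw [cons_eq_mul, mul_smul, mul_smul, h, ih]
    | add s t hs ht =>
      rw [RingHom.id_apply] at hs ht ⊢
      rw [add_smul, add_smul, map_add, hs, ht]

end TensorRingModules

section Pairs

variable {R : Type u} [Ring R]
variable {M : Type u} [AddCommGroup M] [Module R M] [Module Rᵐᵒᵖ M]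
variable {X : Type u} [AddCommGroup X] [Module R X]

/-- The module `X`, with the `T_R(M)`-action given by a linear map `M ⊗_R X → X`. -/
def PairMod (_ : BTensor R M X →ₗ[R] X) : Type u := X

variable (u : BTensor R M X →ₗ[R] X)

instance : AddCommGroup (PairMod u) := inferInstanceAs (AddCommGroup X)

instance : Module R (PairMod u) := inferInstanceAs (Module R X)

instance : Module (TensorRing R M) (PairMod u) :=
  letI : Module (TensorRing R M) X := Module.compHom X (actHom u)
  inferInstanceAs (Module (TensorRing R M) X)

theorem PairMod.smul_eq (t : TensorRing R M) (x : PairMod u) : t • x = act u t x := rfl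

instance : IsScalarTower R (TensorRing R M) (PairMod u) where
  smul_assoc r t x := by
    rw [PairMod.smul_eq, map_smul]
    rfl

theorem PairMod.bimoduleIncl_smul (m : M) (x : PairMod u) :
    bimoduleIncl R M m • x = u (btmul R m x) :=
  (act_cons u m 1 x).trans (congrArg (fun y => u (btmul R m y)) (act_one u x))

theorem PairMod.mulMap_eq (t : BTensor R M X) : mulMap R M (PairMod u) t = u t :=
  LinearMap.congr_fun (f := mulMap R M (PairMod u)) (g := u)
    (btensor_hom_ext fun m x => PairMod.bimoduleIncl_smul u m x) t

end Pairs

/-! ### The induced modules Ind(X) -/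

section Induced

variable (R : Type u) [Ring R]
variable (M : Type u) [AddCommGroup M] [Module R M] [Module Rᵐᵒᵖ M]
variable (X : ModuleCat.{u} R)

/-- The zero map `M ⊗_R X → X`. -/
def zeroStr : BTensor R M X →ₗ[R] X := 0

/-- `X`, with `M` acting as zero. -/
abbrev TrivMod : Type u := PairMod (zeroStr R M X)

/-- The carrier of `Ind(X)`. -/
abbrev IndMod : Type u := PairMod (indMap R M X)

/-- The summand `M^{⊗ i} ⊗_R X` of `Ind(X)`. -/
def indOf (i : ℕ) : tensorPow R M i X →ₗ[R] IndMod R M X :=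
  DirectSum.lof R ℕ (fun i => tensorPow R M i X) i

/-- The summand `X` of `Ind(X)`. -/
def indBase : X →ₗ[R] IndMod R M X := indOf R M X 0

theorem bimoduleIncl_smul_indOf (i : ℕ) (m : M) (y : tensorPow R M i X) :
    bimoduleIncl R M m • indOf R M X i y = indOf R M X (i + 1) (consTensor R M i m y) :=
  (PairMod.bimoduleIncl_smul (indMap R M X) m _).trans (shift_of R M X m i y)

variable {X} in
/-- A linear map on `Ind(X)` from linear maps on the summands. -/
def indElim {Y : Type*} [AddCommGroup Y] [Module R Y] (f : ∀ i, tensorPow R M i X →ₗ[R] Y) :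
    IndMod R M X →ₗ[R] Y :=
  DirectSum.toModule R ℕ Y f

variable {X} in
theorem indElim_indOf {Y : Type*} [AddCommGroup Y] [Module R Y]
    (f : ∀ i, tensorPow R M i X →ₗ[R] Y) (i : ℕ) (y : tensorPow R M i X) :
    indElim R M f (indOf R M X i y) = f i y :=
  DirectSum.toModule_lof (M := fun i => tensorPow R M i X) (φ := f) R i y

variable {R M X}

theorem indMod_induction {p : IndMod R M X → Prop} (z : IndMod R M X) (zero : p 0)
    (of : ∀ i y, p (indOf R M X i y)) (add : ∀ s t, p s → p t → p (s + t)) : p z :=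
  DirectSum.induction_on z zero of add

theorem indMod_hom_ext {Y : Type*} [AddCommGroup Y] [Module R Y] {f g : IndMod R M X →ₗ[R] Y}
    (h : ∀ i y, f (indOf R M X i y) = g (indOf R M X i y)) : f = g := by
  ext z
  induction z using indMod_induction with
  | zero => simp
  | of i y => exact h i y
  | add s t hs ht => rw [map_add, map_add, hs, ht]

section Lift

variable {Y : Type u} [AddCommGroup Y] [Module R Y] [Module (TensorRing R M) Y]
  [IsScalarTower R (TensorRing R M) Y]

/-- The map `M^{⊗ i} ⊗_R X → Y` that a linear map from `X` to a `T_R(M)`-module `Y` induces. -/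
def powLift (φ : X →ₗ[R] Y) : (i : ℕ) → tensorPow R M i X →ₗ[R] Y
  | 0 => φ
  | i + 1 => mulMap R M Y ∘ₗ btmap R M (powLift φ i)

/-- The `T_R(M)`-linear extension `Ind(X) → Y` of a linear map `X → Y`. -/
def indLift (φ : X →ₗ[R] Y) : IndMod R M X →ₗ[TensorRing R M] Y :=
  homOfCommute (indElim R M (powLift φ)) fun m x => by
    induction x using indMod_induction with
    | zero => simp
    | of i y => rw [bimoduleIncl_smul_indOf, indElim_indOf, indElim_indOf]; rfl
    | add s t hs ht => rw [smul_add, map_add, map_add, hs, ht, smul_add]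

theorem indLift_indOf (φ : X →ₗ[R] Y) (i : ℕ) (y : tensorPow R M i X) :
    indLift φ (indOf R M X i y) = powLift φ i y :=
  indElim_indOf R M (powLift φ) i y

theorem indLift_indBase (φ : X →ₗ[R] Y) (x : X) : indLift φ (indBase R M X x) = φ x :=
  indLift_indOf φ 0 x

theorem ind_hom_ext {f g : IndMod R M X →ₗ[TensorRing R M] Y}
    (h : ∀ x : X, f (indBase R M X x) = g (indBase R M X x)) : f = g := by
  have : f.restrictScalars R = g.restrictScalars R := by
    refine indMod_hom_ext fun i => ?_
    induction i with
    | zero => exact h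
    | succ i ih =>
      intro y
      refine LinearMap.congr_fun (f := f.restrictScalars R ∘ₗ indOf R M X (i + 1))
        (g := g.restrictScalars R ∘ₗ indOf R M X (i + 1))
        (btensor_hom_ext (X := tensorPow R M i X) fun m y => ?_) y
      have e := bimoduleIncl_smul_indOf R M X i m y
      refine (congrArg f e.symm).trans (Eq.trans ?_ (congrArg g e))
      rw [map_smul, map_smul]
      exact congrArg _ (ih y)
  exact LinearMap.ext fun z => LinearMap.congr_fun this z

end Lift

variable (R M X) in
/-- The projection of `Ind(X)` to the summand `X`. -/
def indProj : IndMod R M X →ₗ[R] X :=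
  indElim R M fun | 0 => LinearMap.id | _ + 1 => 0

theorem indProj_indBase (x : X) : indProj R M X (indBase R M X x) = x :=
  indElim_indOf R M _ 0 x

theorem indProj_indOf_succ (i : ℕ) (y : tensorPow R M (i + 1) X) :
    indProj R M X (indOf R M X (i + 1) y) = 0 :=
  indElim_indOf R M _ (i + 1) y

theorem indProj_surjective : Function.Surjective (indProj R M X) :=
  fun x => ⟨_, indProj_indBase x⟩

theorem indProj_bimoduleIncl_smul (m : M) (z : IndMod R M X) :
    indProj R M X (bimoduleIncl R M m • z) = 0 := by
  induction z using indMod_induction with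
  | zero => simp
  | of i y => rw [bimoduleIncl_smul_indOf, indProj_indOf_succ]
  | add s t hs ht => rw [smul_add, map_add, hs, ht, add_zero]

variable (R M X) in
/-- The inverse of the isomorphism of `M ⊗_R Ind(X)` with the summand of positive degrees. -/
def indTail : IndMod R M X →ₗ[R] BTensor R M (IndMod R M X) :=
  indElim R M fun | 0 => 0 | i + 1 => btmap R M (indOf R M X i)

theorem indTail_mulMap (t : BTensor R M (IndMod R M X)) :
    indTail R M X (mulMap R M _ t) = t := by
  refine LinearMap.congr_fun (f := indTail R M X ∘ₗ mulMap R M _) (g := LinearMap.id)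
    (btensor_hom_ext fun m z => ?_) t
  change indTail R M X (bimoduleIncl R M m • z) = btmul R m z
  induction z using indMod_induction with
  | zero => simp [btmul_zero]
  | of i y => rw [bimoduleIncl_smul_indOf]; exact indElim_indOf R M _ (i + 1) _
  | add s t hs ht => rw [smul_add, map_add, hs, ht, btmul_add]

theorem mulMap_indTail (z : IndMod R M X) :
    mulMap R M _ (indTail R M X z) + indBase R M X (indProj R M X z) = z := by
  refine LinearMap.congr_fun (f := mulMap R M _ ∘ₗ indTail R M X +
    indBase R M X ∘ₗ indProj R M X) (g := LinearMap.id) (indMod_hom_ext fun i y => ?_) z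
  change mulMap R M _ (indTail R M X (indOf R M X i y)) +
    indBase R M X (indProj R M X (indOf R M X i y)) = indOf R M X i y
  cases i with
  | zero =>
    have h1 : indTail R M X (indOf R M X 0 y) = 0 := indElim_indOf R M _ 0 y
    have h2 : indProj R M X (indOf R M X 0 y) = y := indElim_indOf R M _ 0 y
    rw [h1, h2, map_zero, zero_add]
    rfl
  | succ i =>
    have h1 : indTail R M X (indOf R M X (i + 1) y) = btmap R M (indOf R M X i) y :=
      indElim_indOf R M _ (i + 1) y
    rw [h1, indProj_indOf_succ, LinearMap.map_zero, add_zero]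
    exact LinearMap.congr_fun (f := mulMap R M _ ∘ₗ btmap R M (indOf R M X i))
      (g := indOf R M X (i + 1))
      (btensor_hom_ext fun m y => bimoduleIncl_smul_indOf R M X i m y) y

theorem ind_mulMap_injective : Function.Injective (mulMap R M (IndMod R M X)) :=
  Function.LeftInverse.injective indTail_mulMap

theorem ind_exact : Function.Exact (mulMap R M (IndMod R M X)) (indProj R M X) := by
  intro z
  constructor
  · intro hz
    have := mulMap_indTail z
    rw [hz, map_zero, add_zero] at this
    exact ⟨_, this⟩
  · rintro ⟨t, rfl⟩
    exact LinearMap.congr_fun (f := indProj R M X ∘ₗ mulMap R M _) (g := 0)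
      (btensor_hom_ext fun m z => indProj_bimoduleIncl_smul m z) t

variable (R M X) in
/-- The inclusion `Ind(M ⊗_R X) → Ind(X)`. -/
def indShift : IndMod R M (ModuleCat.of R (BTensor R M X)) →ₗ[TensorRing R M] IndMod R M X :=
  indLift (X := ModuleCat.of R (BTensor R M X)) (indOf R M X 1)

theorem indShift_indOf (i : ℕ) (y : tensorPow R M i (ModuleCat.of R (BTensor R M X))) :
    indShift R M X (indOf R M _ i y) = indOf R M X (i + 1) (tensorPowSucc R M X i y) := by
  refine (indLift_indOf _ i y).trans ?_
  induction i with
  | zero => rfl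
  | succ i ih =>
    refine LinearMap.congr_fun (f := powLift (indOf R M X 1) (i + 1))
      (g := indOf R M X (i + 1 + 1) ∘ₗ (tensorPowSucc R M X (i + 1)).toLinearMap)
      (btensor_hom_ext fun m y => ?_) y
    change bimoduleIncl R M m • powLift (indOf R M X 1) i y = _
    refine (congrArg _ (ih y)).trans ?_
    rw [bimoduleIncl_smul_indOf]
    rfl

variable (R M X) in
/-- A left inverse of `indShift`. -/
def indUnshift : IndMod R M X →ₗ[R] IndMod R M (ModuleCat.of R (BTensor R M X)) :=
  indElim R M fun
    | 0 => 0
    | i + 1 => indOf R M (ModuleCat.of R (BTensor R M X)) i ∘ₗ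
        (tensorPowSucc R M X i).symm.toLinearMap

theorem indUnshift_indShift (z : IndMod R M (ModuleCat.of R (BTensor R M X))) :
    indUnshift R M X (indShift R M X z) = z := by
  induction z using indMod_induction with
  | zero => simp
  | of i y =>
    rw [indShift_indOf]
    refine (indElim_indOf R M _ (i + 1) _).trans ?_
    change indOf R M _ i ((tensorPowSucc R M X i).symm (tensorPowSucc R M X i y)) = _
    rw [LinearEquiv.symm_apply_apply]
  | add s t hs ht => rw [map_add, map_add, hs, ht]

theorem indShift_indUnshift (z : IndMod R M X) :
    indShift R M X (indUnshift R M X z) + indBase R M X (indProj R M X z) = z := by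
  induction z using indMod_induction with
  | zero => simp
  | of i y =>
    cases i with
    | zero =>
      have h1 : indUnshift R M X (indOf R M X 0 y) = 0 := indElim_indOf R M _ 0 y
      have h2 : indProj R M X (indOf R M X 0 y) = y := indElim_indOf R M _ 0 y
      rw [h1, h2, map_zero, zero_add]
      rfl
    | succ i =>
      have h1 : indUnshift R M X (indOf R M X (i + 1) y) =
          indOf R M _ i ((tensorPowSucc R M X i).symm y) := indElim_indOf R M _ (i + 1) y
      rw [h1, indProj_indOf_succ, map_zero, add_zero, indShift_indOf, LinearEquiv.apply_symm_apply]
  | add s t hs ht =>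
    rw [map_add, map_add, map_add, map_add]
    nth_rewrite 3 [← hs]
    nth_rewrite 3 [← ht]
    abel

variable (R M X) in
/-- The projection `Ind(X) → X`, as a `T_R(M)`-linear map to `X` with `M` acting as zero. -/
def indAug : IndMod R M X →ₗ[TensorRing R M] TrivMod R M X :=
  homOfCommute (show IndMod R M X →ₗ[R] TrivMod R M X from indProj R M X) fun m z => by
    rw [PairMod.bimoduleIncl_smul (zeroStr R M X)]
    exact indProj_bimoduleIncl_smul m z

theorem indAug_surjective : Function.Surjective (indAug R M X) := indProj_surjective

theorem indShift_injective : Function.Injective (indShift R M X) :=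
  Function.LeftInverse.injective indUnshift_indShift

/-- The sequence `0 → Ind(M ⊗_R X) → Ind(X) → X → 0`. -/
theorem indShift_exact : Function.Exact (indShift R M X) (indAug R M X) := by
  intro z
  constructor
  · intro hz
    have := indShift_indUnshift z
    rw [show indProj R M X z = 0 from hz, map_zero, add_zero] at this
    exact ⟨_, this⟩
  · rintro ⟨w, rfl⟩
    induction w using indMod_induction with
    | zero => simp
    | of i y => rw [indShift_indOf]; exact indProj_indOf_succ i _
    | add s t hs ht => rw [map_add, map_add, hs, ht, add_zero]

/-- Ind is left adjoint to restriction of scalars, which preserves surjections. -/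
instance [Module.Projective R X] : Module.Projective (TensorRing R M) (IndMod R M X) := by
  refine Module.Projective.of_lifting_property'' fun f hf => ?_
  obtain ⟨g, hg⟩ := Module.projective_lifting_property (f.restrictScalars R) (indBase R M X) hf
  refine ⟨indLift g, ind_hom_ext fun x => ?_⟩
  rw [LinearMap.comp_apply, indLift_indBase]
  exact LinearMap.congr_fun hg x

theorem indMod_subsingleton (h : ∀ i, Subsingleton (tensorPow R M i X)) :
    Subsingleton (IndMod R M X) := by
  have : ∀ z : IndMod R M X, z = 0 := fun z => by
    induction z using indMod_induction with
    | zero => rfl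
    | of i y => rw [Subsingleton.elim y 0, map_zero]
    | add s t hs ht => rw [hs, ht, add_zero]
  exact ⟨fun a b => by rw [this a, this b]⟩

/-- A projective `T_R(M)`-module is a direct summand of `Ind(P)` for a projective module `P`. -/
theorem exists_retract (Q : Type u) [AddCommGroup Q] [Module R Q] [Module (TensorRing R M) Q]
    [IsScalarTower R (TensorRing R M) Q] [Module.Projective (TensorRing R M) Q] :
    ∃ (P : ModuleCat.{u} R) (s : Q →ₗ[TensorRing R M] IndMod R M P)
      (r : IndMod R M P →ₗ[TensorRing R M] Q), Module.Projective R P ∧ ∀ x, r (s x) = x := by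
  let φ : ModuleCat.of R (Q →₀ R) →ₗ[R] Q := Finsupp.linearCombination R id
  have hφ : Function.Surjective (indLift (M := M) φ) := fun x => by
    obtain ⟨y, rfl⟩ := Finsupp.linearCombination_id_surjective R Q x
    exact ⟨_, indLift_indBase φ y⟩
  obtain ⟨s, hs⟩ := Module.projective_lifting_property (indLift (M := M) φ)
    (LinearMap.id : Q →ₗ[TensorRing R M] Q) hφ
  exact ⟨ModuleCat.of R (Q →₀ R), s, indLift φ, inferInstanceAs (Module.Projective R (Q →₀ R)),
    fun x => LinearMap.congr_fun hs x⟩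

end Induced

/-! ### The cokernel functor X ↦ X / M X -/

section Cokernel

variable (R : Type u) [Ring R]
variable (M : Type u) [AddCommGroup M] [Module R M] [Module Rᵐᵒᵖ M]

section

variable (X : Type u) [AddCommGroup X] [Module R X] [Module (TensorRing R M) X]
  [IsScalarTower R (TensorRing R M) X]

/-- The cokernel `X / M X` of the structure map of a `T_R(M)`-module. -/
abbrev Cok : Type u := X ⧸ LinearMap.range (mulMap R M X)

/-- The projection `X → X / M X`. -/
def cokMk : X →ₗ[R] Cok R M X := (LinearMap.range (mulMap R M X)).mkQ

variable {X}

theorem cokMk_surjective : Function.Surjective (cokMk R M X) := Submodule.mkQ_surjective _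

theorem cokMk_eq_zero {x : X} : cokMk R M X x = 0 ↔ ∃ t, mulMap R M X t = x :=
  Submodule.Quotient.mk_eq_zero _

theorem cokMk_mulMap (t : BTensor R M X) : cokMk R M X (mulMap R M X t) = 0 :=
  (cokMk_eq_zero R M).2 ⟨t, rfl⟩

theorem exact_mulMap_cokMk : Function.Exact (mulMap R M X) (cokMk R M X) :=
  fun _ => cokMk_eq_zero R M

theorem exists_cok_desc {P : Type u} [AddCommGroup P] [Module R P] (f : X →ₗ[R] P)
    (hf : ∀ t, f (mulMap R M X t) = 0) : ∃ f' : Cok R M X →ₗ[R] P, ∀ x, f' (cokMk R M X x) = f x :=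
  exists_desc _ (cokMk_surjective R M) f fun x hx => by
    obtain ⟨t, rfl⟩ := (cokMk_eq_zero R M).1 hx
    exact hf t

end

variable {W X Y Z : Type u}
  [AddCommGroup W] [Module R W] [Module (TensorRing R M) W] [IsScalarTower R (TensorRing R M) W]
  [AddCommGroup X] [Module R X] [Module (TensorRing R M) X] [IsScalarTower R (TensorRing R M) X]
  [AddCommGroup Y] [Module R Y] [Module (TensorRing R M) Y] [IsScalarTower R (TensorRing R M) Y]
  [AddCommGroup Z] [Module R Z] [Module (TensorRing R M) Z] [IsScalarTower R (TensorRing R M) Z]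

/-- The map `X / M X → Y / M Y` that a `T_R(M)`-linear map induces. -/
def cokMap (f : X →ₗ[TensorRing R M] Y) : Cok R M X →ₗ[R] Cok R M Y :=
  Submodule.mapQ _ _ (f.restrictScalars R) (by
    rintro _ ⟨t, rfl⟩
    exact ⟨_, (map_mulMap R M f t).symm⟩)

theorem cokMap_cokMk (f : X →ₗ[TensorRing R M] Y) (x : X) :
    cokMap R M f (cokMk R M X x) = cokMk R M Y (f x) := rfl

/-- If g x lies in M Y, then `hM` lets x be corrected by an element of M X until it lies in ker g.
The condition holds when g is surjective, and also when M ⊗ - is exact at Y and the next structure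
map is injective. -/
theorem cokMap_exact_of_lift (f : W →ₗ[TensorRing R M] X) (g : X →ₗ[TensorRing R M] Y)
    (hfg : Function.Exact f g)
    (hM : ∀ x t, mulMap R M Y t = g x → ∃ s, btmap R M (g.restrictScalars R) s = t) :
    Function.Exact (cokMap R M f) (cokMap R M g) := by
  intro c
  obtain ⟨x, rfl⟩ := cokMk_surjective R M c
  constructor
  · intro hx
    rw [cokMap_cokMk, cokMk_eq_zero] at hx
    obtain ⟨t, ht⟩ := hx
    obtain ⟨s, rfl⟩ := hM x t ht
    rw [← map_mulMap] at ht
    obtain ⟨w, hw⟩ := (hfg (x - mulMap R M X s)).1 (by rw [map_sub, ht, sub_self])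
    refine ⟨cokMk R M W w, ?_⟩
    rw [cokMap_cokMk, hw, map_sub, cokMk_mulMap, sub_zero]
  · rintro ⟨c, hc⟩
    obtain ⟨w, rfl⟩ := cokMk_surjective R M c
    rw [← hc, cokMap_cokMk, cokMap_cokMk, hfg.apply_apply_eq_zero, map_zero]

theorem cokMap_exact_of_surjective (f : W →ₗ[TensorRing R M] X) (g : X →ₗ[TensorRing R M] Y)
    (hfg : Function.Exact f g) (hg : Function.Surjective g) :
    Function.Exact (cokMap R M f) (cokMap R M g) :=
  cokMap_exact_of_lift R M f g hfg fun _ t _ => btmap_surjective R M (g.restrictScalars R) hg t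

/-- For exact sequences `W → X → Y → Z` of `T_R(M)`-modules. -/
theorem cokMap_exact (f : W →ₗ[TensorRing R M] X) (g : X →ₗ[TensorRing R M] Y)
    (h : Y →ₗ[TensorRing R M] Z) (hfg : Function.Exact f g) (hgh : ∀ x, h (g x) = 0)
    (hM : Function.Exact (btmap R M (g.restrictScalars R)) (btmap R M (h.restrictScalars R)))
    (hZ : Function.Injective (mulMap R M Z)) :
    Function.Exact (cokMap R M f) (cokMap R M g) :=
  cokMap_exact_of_lift R M f g hfg fun x t ht =>
    (hM t).1 (hZ (by rw [← map_mulMap, ht, hgh, map_zero]))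

theorem cokMap_injective (f : X →ₗ[TensorRing R M] Y) (g : Y →ₗ[TensorRing R M] Z)
    (hf : Function.Injective f) (hfg : ∀ x, g (f x) = 0)
    (hM : Function.Exact (btmap R M (f.restrictScalars R)) (btmap R M (g.restrictScalars R)))
    (hZ : Function.Injective (mulMap R M Z)) : Function.Injective (cokMap R M f) := by
  rw [injective_iff_map_eq_zero]
  intro c hc
  obtain ⟨x, rfl⟩ := cokMk_surjective R M c
  rw [cokMap_cokMk, cokMk_eq_zero] at hc
  obtain ⟨t, ht⟩ := hc
  obtain ⟨s, rfl⟩ := (hM t).1 (hZ (by rw [← map_mulMap, ht, hfg, map_zero]))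
  rw [← map_mulMap] at ht
  exact (cokMk_eq_zero R M).2 ⟨s, hf ht⟩

theorem mulMap_injective_of_injective (f : X →ₗ[TensorRing R M] Y)
    (hf : Function.Injective (btmap R M (f.restrictScalars R)))
    (hY : Function.Injective (mulMap R M Y)) : Function.Injective (mulMap R M X) := by
  intro a b hab
  apply hf
  apply hY
  rw [← map_mulMap, ← map_mulMap, hab]

section Projective

variable (Q : Type u) [AddCommGroup Q] [Module R Q] [Module (TensorRing R M) Q]
  [IsScalarTower R (TensorRing R M) Q] [Module.Projective (TensorRing R M) Q]

theorem mulMap_injective_of_projective : Function.Injective (mulMap R M Q) := by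
  obtain ⟨P, s, r, -, h⟩ := exists_retract (R := R) (M := M) Q
  refine mulMap_injective_of_injective R M s ?_ ind_mulMap_injective
  exact Function.LeftInverse.injective
    (btmap_leftInverse R M (r.restrictScalars R) (s.restrictScalars R) h)

/-- A retraction of Ind(P) onto Q induces one of Ind(P)/M Ind(P) ≅ P onto Q/M Q. -/
theorem cok_projective : Module.Projective R (Cok R M Q) := by
  obtain ⟨P, s, r, _, h⟩ := exists_retract (R := R) (M := M) Q
  obtain ⟨a, ha⟩ := exists_cok_desc R M (indProj R M P ∘ₗ s.restrictScalars R) fun t => by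
    refine (congrArg (indProj R M P) (map_mulMap R M s t)).trans ?_
    exact ind_exact.apply_apply_eq_zero _
  refine Module.Projective.of_split a (cokMk R M Q ∘ₗ r.restrictScalars R ∘ₗ indBase R M P) ?_
  refine LinearMap.ext fun c => ?_
  obtain ⟨x, rfl⟩ := cokMk_surjective R M c
  have h1 : r (indBase R M P (indProj R M P (s x))) =
      x - mulMap R M Q (btmap R M (r.restrictScalars R) (indTail R M P (s x))) := by
    rw [← map_mulMap, eq_sub_iff_add_eq, ← map_add, add_comm, mulMap_indTail, h]
  rw [LinearMap.comp_apply, ha]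
  change cokMk R M Q (r (indBase R M P (indProj R M P (s x)))) = cokMk R M Q x
  rw [h1, map_sub, cokMk_mulMap, sub_zero]

end Projective

end Cokernel

/-! ### Gorenstein projective T_R(M)-modules lie in Φ(GP(R)) -/

section Restriction

variable {R : Type u} [Ring R]
variable {M : Type u} [AddCommGroup M] [Module R M] [Module Rᵐᵒᵖ M]

/-- The `R`-module structure of a `T_R(M)`-module. -/
abbrev baseModule (X : ModuleCat.{u} (TensorRing R M)) : Module R X :=
  Module.compHom X (baseHom R M)

attribute [local instance] baseModule

theorem baseModule_isScalarTower (X : ModuleCat.{u} (TensorRing R M)) :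
    IsScalarTower R (TensorRing R M) X where
  smul_assoc r t x := by
    rw [← base_mul, mul_smul]
    rfl

attribute [local instance] baseModule_isScalarTower

variable (Q : CompleteProjectiveResolution (TensorRing R M))

/-- `Hom(Q, P)` is exact for a projective `R`-module `P` on which `M` acts as zero. -/
theorem hom_trivMod_exact (P : ModuleCat.{u} R) [Module.Projective R P]
    (hQ : ∀ i, Function.Exact
        (fun f : Q.X (i + 1 + 1) →ₗ[TensorRing R M] IndMod R M (ModuleCat.of R (BTensor R M P)) =>
          f ∘ₗ Q.d (i + 1))
        (fun f : Q.X (i + 1) →ₗ[TensorRing R M] IndMod R M (ModuleCat.of R (BTensor R M P)) =>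
          f ∘ₗ Q.d i))
    (i : ℤ) (f : Q.X (i + 1) →ₗ[TensorRing R M] TrivMod R M P) (hf : ∀ x, f (Q.d i x) = 0) :
    ∃ h : Q.X (i + 1 + 1) →ₗ[TensorRing R M] TrivMod R M P, ∀ x, h (Q.d (i + 1) x) = f x := by
  -- This is the long exact sequence of the Hom complexes of 0 → Ind(M ⊗ P) → Ind(P) → P → 0. The
  -- connecting class `g` sits on `Q.X (k + 1)`, where (C2) makes it a coboundary.
  obtain ⟨k, rfl⟩ : ∃ k, i = k + 1 := ⟨i - 1, by omega⟩
  have := Q.projective (k + 1 + 1)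
  obtain ⟨f₁, hf₁⟩ := Module.projective_lifting_property (indAug R M P) f indAug_surjective
  have hf₁' : ∀ x, indAug R M P (f₁ x) = f x := fun x => LinearMap.congr_fun hf₁ x
  obtain ⟨g, hg⟩ := exists_factor (indShift R M P) indShift_injective (f₁ ∘ₗ Q.d (k + 1))
    fun y => (indShift_exact _).1 ((hf₁' _).trans (hf y))
  obtain ⟨g', hg'⟩ := (hQ k g).1 (LinearMap.ext fun x => indShift_injective (by
    refine (hg _).trans ?_
    rw [LinearMap.comp_apply, (Q.exact k).apply_apply_eq_zero]
    simp))
  -- Subtracting the correction turns the lift `f₁` into a cocycle without changing its projection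
  -- to P; it is a coboundary because Ind(P) is projective.
  obtain ⟨h, hh⟩ := (Q.hom_exact (ModuleCat.of _ (IndMod R M P))
    (inferInstanceAs (Module.Projective (TensorRing R M) (IndMod R M P))) (k + 1)
    (f₁ - indShift R M P ∘ₗ g')).1 (LinearMap.ext fun x => by
      have h1 : g' (Q.d (k + 1) x) = g x := LinearMap.congr_fun hg' x
      have h2 : indShift R M P (g x) = f₁ (Q.d (k + 1) x) := hg x
      change f₁ (Q.d (k + 1) x) - indShift R M P (g' (Q.d (k + 1) x)) = 0
      rw [h1, h2, sub_self])
  refine ⟨indAug R M P ∘ₗ h, fun x => ?_⟩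
  have h1 : h (Q.d (k + 1 + 1) x) = f₁ x - indShift R M P (g' x) := LinearMap.congr_fun hh x
  rw [LinearMap.comp_apply, h1, map_sub, hf₁', indShift_exact.apply_apply_eq_zero, sub_zero]

/-- The complete projective resolution of `R`-modules `Q / M Q`. -/
def cokResolution
    (hQ₁ : ∀ i, Function.Exact (btmap R M ((Q.d i).restrictScalars R))
      (btmap R M ((Q.d (i + 1)).restrictScalars R)))
    (hQ₂ : ∀ P : ModuleCat.{u} R, Module.Projective R P → ∀ i, Function.Exact
        (fun f : Q.X (i + 1 + 1) →ₗ[TensorRing R M] IndMod R M (ModuleCat.of R (BTensor R M P)) =>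
          f ∘ₗ Q.d (i + 1))
        (fun f : Q.X (i + 1) →ₗ[TensorRing R M] IndMod R M (ModuleCat.of R (BTensor R M P)) =>
          f ∘ₗ Q.d i)) : CompleteProjectiveResolution R where
  X i := ModuleCat.of R (Cok R M (Q.X i))
  d i := cokMap R M (Q.d i)
  projective i := by
    have := Q.projective i
    exact cok_projective R M (Q.X i)
  exact i := by
    have := Q.projective (i + 1 + 1 + 1)
    exact cokMap_exact R M (Q.d i) (Q.d (i + 1)) (Q.d (i + 1 + 1)) (Q.exact i)
      (Q.exact (i + 1)).apply_apply_eq_zero (hQ₁ (i + 1)) (mulMap_injective_of_projective R M _)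
  hom_exact P hP i f := by
    constructor
    · intro hf
      -- R-linear maps from X / M X to P are the T_R(M)-linear maps from X to P with M acting as
      -- zero.
      let f₁ : Q.X (i + 1) →ₗ[TensorRing R M] TrivMod R M P :=
        homOfCommute (show Q.X (i + 1) →ₗ[R] TrivMod R M P from f ∘ₗ cokMk R M (Q.X (i + 1)))
          fun m x => by
            rw [PairMod.bimoduleIncl_smul (zeroStr R M P)]
            exact (congrArg f (cokMk_mulMap R M (btmul R m x))).trans (map_zero f)
      obtain ⟨h, hh⟩ := hom_trivMod_exact Q P (hQ₂ P hP) i f₁ fun x =>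
        LinearMap.congr_fun hf (cokMk R M (Q.X i) x)
      obtain ⟨h', hh'⟩ := exists_cok_desc R M
        (show Q.X (i + 1 + 1) →ₗ[R] P from h.restrictScalars R) fun t => by
          refine (map_mulMap R M h t).trans ?_
          exact PairMod.mulMap_eq (zeroStr R M P) _
      refine ⟨h', LinearMap.ext fun c => ?_⟩
      obtain ⟨x, rfl⟩ := cokMk_surjective R M c
      exact (hh' _).trans (hh x)
    · rintro ⟨h, rfl⟩
      refine LinearMap.ext fun c => ?_
      obtain ⟨x, rfl⟩ := cokMk_surjective R M c
      change h (cokMk R M _ (Q.d (i + 1) (Q.d i x))) = 0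
      rw [(Q.exact i).apply_apply_eq_zero, map_zero, map_zero]

theorem mulMap_injective_and_gp_cok
    (hQ₁ : ∀ i, Function.Exact (btmap R M ((Q.d i).restrictScalars R))
      (btmap R M ((Q.d (i + 1)).restrictScalars R)))
    (hQ₂ : ∀ P : ModuleCat.{u} R, Module.Projective R P → ∀ i, Function.Exact
        (fun f : Q.X (i + 1 + 1) →ₗ[TensorRing R M] IndMod R M (ModuleCat.of R (BTensor R M P)) =>
          f ∘ₗ Q.d (i + 1))
        (fun f : Q.X (i + 1) →ₗ[TensorRing R M] IndMod R M (ModuleCat.of R (BTensor R M P)) =>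
          f ∘ₗ Q.d i))
    {X : Type u} [AddCommGroup X] [Module R X] [Module (TensorRing R M) X]
    [IsScalarTower R (TensorRing R M) X] (j : ℤ) (e : X →ₗ[TensorRing R M] Q.X j)
    (he : Function.Injective e) (hed : Function.Exact e (Q.d j)) :
    Function.Injective (mulMap R M X) ∧ GP R (ModuleCat.of R (Cok R M X)) := by
  obtain ⟨k, rfl⟩ : ∃ k, j = k + 1 + 1 := ⟨j - 2, by omega⟩
  have := Q.projective (k + 1 + 1)
  have := Q.projective (k + 1 + 1 + 1)
  have := Q.projective (k + 1 + 1 + 1 + 1)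
  obtain ⟨p, hp⟩ := exists_factor e he (Q.d (k + 1)) fun y =>
    (hed _).1 ((Q.exact (k + 1) _).2 ⟨y, rfl⟩)
  have hps : Function.Surjective p := fun x => by
    obtain ⟨y, hy⟩ := (Q.exact (k + 1) _).1 (hed.apply_apply_eq_zero x)
    exact ⟨y, he ((hp y).trans hy)⟩
  have hep : e.restrictScalars R ∘ₗ p.restrictScalars R = (Q.d (k + 1)).restrictScalars R :=
    LinearMap.ext hp
  have hpM := btmap_surjective R M (p.restrictScalars R) hps
  -- An element killed in M ⊗ Q lifts along the surjection `p` to a cycle of M ⊗ Q, hence by (C1) to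
  -- a boundary, and `p` kills boundaries.
  have heM : Function.Injective (btmap R M (e.restrictScalars R)) := by
    rw [injective_iff_map_eq_zero]
    intro t ht
    obtain ⟨s, rfl⟩ := hpM t
    rw [btmap_btmap, hep] at ht
    obtain ⟨r, rfl⟩ := (hQ₁ k s).1 ht
    rw [btmap_btmap]
    refine btmap_eq_zero R M _ (fun x => he ?_) r
    exact ((hp _).trans ((Q.exact k).apply_apply_eq_zero x)).trans (map_zero e).symm
  have hedM : Function.Exact (btmap R M (e.restrictScalars R))
      (btmap R M ((Q.d (k + 1 + 1)).restrictScalars R)) := by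
    intro t
    rw [hQ₁ (k + 1) t]
    constructor
    · rintro ⟨s, rfl⟩
      exact ⟨btmap R M (p.restrictScalars R) s, by rw [btmap_btmap, hep]⟩
    · rintro ⟨s, rfl⟩
      obtain ⟨r, rfl⟩ := hpM s
      exact ⟨r, by rw [btmap_btmap, hep]⟩
  refine ⟨mulMap_injective_of_injective R M e heM (mulMap_injective_of_projective R M _), ?_⟩
  refine IsSyzygy.gp ⟨cokResolution Q hQ₁ hQ₂, k + 1 + 1, cokMap R M e, ?_, ?_⟩
  · exact cokMap_injective R M e (Q.d (k + 1 + 1)) he hed.apply_apply_eq_zero hedM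
      (mulMap_injective_of_projective R M _)
  · exact cokMap_exact R M e (Q.d (k + 1 + 1)) (Q.d (k + 1 + 1 + 1)) hed
      (Q.exact (k + 1 + 1)).apply_apply_eq_zero (hQ₁ (k + 1 + 1))
      (mulMap_injective_of_projective R M _)

end Restriction

/-! ### Uniqueness of kernels and cokernels; functoriality of tensor powers -/

section LinearAlgebra

variable {A : Type*} [Ring A] {B C P G : Type*} [AddCommGroup B] [Module A B]
  [AddCommGroup C] [Module A C] [AddCommGroup P] [Module A P] [AddCommGroup G] [Module A G]

/-- Two kernels of the same map are isomorphic. -/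
def kernelEquiv (f : B →ₗ[A] P) (g : C →ₗ[A] P) (p : P →ₗ[A] G) (hf : Function.Injective f)
    (hg : Function.Injective g) (hfp : Function.Exact f p) (hgp : Function.Exact g p) : B ≃ₗ[A] C :=
  (LinearEquiv.ofInjective f hf).trans
    ((LinearEquiv.ofEq _ _ (hfp.linearMap_ker_eq.symm.trans hgp.linearMap_ker_eq)).trans
      (LinearEquiv.ofInjective g hg).symm)

/-- Two cokernels of the same map are isomorphic. -/
def cokernelEquiv (p : P →ₗ[A] B) (q : P →ₗ[A] C) (i : G →ₗ[A] P) (hp : Function.Surjective p)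
    (hq : Function.Surjective q) (hip : Function.Exact i p) (hiq : Function.Exact i q) :
    B ≃ₗ[A] C :=
  (p.quotKerEquivOfSurjective hp).symm.trans
    ((Submodule.quotEquivOfEq _ _ (hip.linearMap_ker_eq.trans hiq.linearMap_ker_eq.symm)).trans
      (q.quotKerEquivOfSurjective hq))

end LinearAlgebra

section TensorPowers

variable (R : Type u) [Ring R]
variable (M : Type u) [AddCommGroup M] [Module R M] [Module Rᵐᵒᵖ M]
variable {X Y Z W : ModuleCat.{u} R}

theorem tpmap_tpmap (g : Y →ₗ[R] Z) (f : X →ₗ[R] Y) (i : ℕ) (t : tensorPow R M i X) :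
    tpmap R M g i (tpmap R M f i t) = tpmap R M (g ∘ₗ f) i t := by
  induction i with
  | zero => rfl
  | succ i ih =>
    refine (btmap_btmap R M (tpmap R M g i) (tpmap R M f i) t).trans ?_
    have : tpmap R M g i ∘ₗ tpmap R M f i = tpmap R M (g ∘ₗ f) i := LinearMap.ext ih
    rw [this]
    rfl

theorem tpmap_id (i : ℕ) (t : tensorPow R M i X) :
    tpmap R M (LinearMap.id : X →ₗ[R] X) i t = t := by
  induction i with
  | zero => rfl
  | succ i ih =>
    have : tpmap R M (LinearMap.id : X →ₗ[R] X) i = LinearMap.id := LinearMap.ext ih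
    change btmap R M (tpmap R M (LinearMap.id : X →ₗ[R] X) i) t = t
    rw [this]
    exact btmap_id R M _

theorem tpmap_injective_of_leftInverse (g : Y →ₗ[R] X) (f : X →ₗ[R] Y) (h : ∀ x, g (f x) = x)
    (i : ℕ) : Function.Injective (tpmap R M f i) :=
  Function.LeftInverse.injective (g := tpmap R M g i) fun t => by
    rw [tpmap_tpmap, show g ∘ₗ f = LinearMap.id from LinearMap.ext h, tpmap_id]

theorem tensorPowSucc_tpmap (f : X →ₗ[R] Y) (i : ℕ)
    (t : tensorPow R M i (ModuleCat.of R (BTensor R M X))) :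
    tensorPowSucc R M Y i (tpmap R M (X := ModuleCat.of R (BTensor R M X))
      (Y := ModuleCat.of R (BTensor R M Y)) (btmap R M f) i t) =
      tpmap R M f (i + 1) (tensorPowSucc R M X i t) := by
  induction i with
  | zero => rfl
  | succ i ih =>
    let b := tpmap R M (X := ModuleCat.of R (BTensor R M X))
      (Y := ModuleCat.of R (BTensor R M Y)) (btmap R M f) i
    have : (tensorPowSucc R M Y i).toLinearMap ∘ₗ b =
        tpmap R M f (i + 1) ∘ₗ (tensorPowSucc R M X i).toLinearMap := LinearMap.ext ih
    change btmap R M (tensorPowSucc R M Y i).toLinearMap (btmap R M b t) =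
      btmap R M (tpmap R M f (i + 1)) (btmap R M (tensorPowSucc R M X i).toLinearMap t)
    exact (btmap_btmap R M _ _ _).trans
      ((congrArg (fun g => btmap R M g t) this).trans (btmap_btmap R M _ _ _).symm)

end TensorPowers

/-! ### Ext and Tor vanishing for modules with injective structure map -/

section Phi

variable {R : Type u} [Ring R]
variable {M : Type u} [AddCommGroup M] [Module R M] [Module Rᵐᵒᵖ M]
variable {X Y : Type u} [AddCommGroup X] [Module R X] [Module (TensorRing R M) X]
  [IsScalarTower R (TensorRing R M) X]
  [AddCommGroup Y] [Module R Y] [Module (TensorRing R M) Y]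
  [IsScalarTower R (TensorRing R M) Y]

variable (R M) in
theorem compHom_isScalarTower (K : Type u) [AddCommGroup K] [Module (TensorRing R M) K] :
    letI : Module R K := Module.compHom K (baseHom R M)
    IsScalarTower R (TensorRing R M) K :=
  letI : Module R K := Module.compHom K (baseHom R M)
  { smul_assoc := fun r t x => by
      rw [← base_mul, mul_smul]
      rfl }

variable (M) in
/-- `Ext¹_T(X, Y) = 0` for a module `Y` on which `M` acts as zero. -/
theorem extVanish_trivMod (hX : Function.Injective (mulMap R M X)) (Y : ModuleCat.{u} R)
    (h : ExtVanish R (Cok R M X) Y) : ExtVanish (TensorRing R M) X (TrivMod R M Y) := by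
  intro K L _ _ _ _ _ i p hi hip hp g
  let _ : Module R K := Module.compHom K (baseHom R M)
  let _ : Module R L := Module.compHom L (baseHom R M)
  have := compHom_isScalarTower R M K
  have := compHom_isScalarTower R M L
  -- Injectivity of the structure map of X gives 0 → K/MK → L/ML → X/MX → 0, with `K'` in the role
  -- of K/MK. Since g kills M K, it factors through `K'`, and the R-linear Ext vanishing extends it
  -- to L/ML.
  let K' : Submodule R (Cok R M L) := LinearMap.ker (cokMap R M p)
  have hc : ∀ k : K, (cokMk R M L ∘ₗ i.restrictScalars R) k ∈ K' := fun k => by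
    change cokMap R M p (cokMk R M L (i k)) = 0
    rw [cokMap_cokMk, hip.apply_apply_eq_zero, map_zero]
  let c : K →ₗ[R] K' := (cokMk R M L ∘ₗ i.restrictScalars R).codRestrict K' hc
  have hexM := btmap_exact R M (i.restrictScalars R) (p.restrictScalars R) hip hp
  have hcs : Function.Surjective c := by
    rintro ⟨y, hy⟩
    obtain ⟨k, rfl⟩ := (cokMap_exact_of_surjective R M i p hip hp y).1 hy
    obtain ⟨k, rfl⟩ := cokMk_surjective R M k
    exact ⟨k, rfl⟩
  obtain ⟨g', hg'⟩ := exists_desc c hcs (show K →ₗ[R] Y from g.restrictScalars R) fun k hk => by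
    obtain ⟨t, ht⟩ : ∃ t, mulMap R M L t = i k :=
      (cokMk_eq_zero R M).1 (congrArg Subtype.val hk)
    obtain ⟨s, rfl⟩ := (hexM t).1 (hX (by
      rw [← map_mulMap, ht, hip.apply_apply_eq_zero, map_zero]))
    rw [← map_mulMap] at ht
    rw [← hi ht]
    exact (map_mulMap R M g s).trans (PairMod.mulMap_eq (zeroStr R M Y) _)
  obtain ⟨h', hh'⟩ := h.extend K'.subtype_injective
    (LinearMap.exact_subtype_ker_map (cokMap R M p)) (fun x => by
      obtain ⟨x, rfl⟩ := cokMk_surjective R M x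
      obtain ⟨y, rfl⟩ := hp x
      exact ⟨cokMk R M L y, rfl⟩) g'
  refine ⟨homOfCommute (show L →ₗ[R] TrivMod R M Y from h' ∘ₗ cokMk R M L) fun m x => ?_,
    fun k => ?_⟩
  · rw [PairMod.bimoduleIncl_smul (zeroStr R M Y)]
    exact (congrArg h' (cokMk_mulMap R M (btmul R m x))).trans (map_zero h')
  · exact (hh' (c k)).trans (hg' k)

variable {N : ℕ} (hN : IsNilpotentBimodule R M N)
include hN

theorem extVanish_indMod (hX : Function.Injective (mulMap R M X)) (P : ModuleCat.{u} R)
    (h : ∀ i, ExtVanish R (Cok R M X) (tensorPow R M i P)) (i : ℕ) :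
    ExtVanish (TensorRing R M) X (IndMod R M (tensorPow R M i P)) := by
  -- Descending induction on i: `k` bounds the distance to degree N + 1, where the module is zero.
  suffices H : ∀ k i, N + 1 ≤ i + k →
      ExtVanish (TensorRing R M) X (IndMod R M (tensorPow R M i P)) from H (N + 1) i (by omega)
  intro k
  induction k with
  | zero =>
    intro i hi
    have h0 : Subsingleton (tensorPow R M i P) :=
      tensorPow_subsingleton_of_le R M hi P (tensorPow_subsingleton R M hN P)
    have := indMod_subsingleton fun j =>
      tensorPow_subsingleton_of_le R M (Nat.zero_le j) (tensorPow R M i P) h0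
    exact ExtVanish.of_subsingleton
  | succ k ih =>
    intro i hi
    exact ExtVanish.of_exact indShift_injective indShift_exact indAug_surjective
      (ih (i + 1) (by omega)) (extVanish_trivMod M hX _ (h i))

theorem extVanish_projective (hX : Function.Injective (mulMap R M X))
    (h : ∀ P : ModuleCat.{u} R, Module.Projective R P → ∀ i,
      ExtVanish R (Cok R M X) (tensorPow R M i P))
    (Q : Type u) [AddCommGroup Q] [Module (TensorRing R M) Q]
    [Module.Projective (TensorRing R M) Q] : ExtVanish (TensorRing R M) X Q := by
  let _ : Module R Q := Module.compHom Q (baseHom R M)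
  have := compHom_isScalarTower R M Q
  obtain ⟨P, s, r, hP, hrs⟩ := exists_retract (R := R) (M := M) Q
  exact (extVanish_indMod hN hX P (h P hP) 0).of_retract s r hrs

theorem torVanish_of_cok (hX : Function.Injective (mulMap R M X))
    (h : ∀ i, TorVanish R M (tensorPow R M i (ModuleCat.of R (Cok R M X)))) (i : ℕ) :
    TorVanish R M (tensorPow R M i (ModuleCat.of R X)) := by
  suffices H : ∀ k i, N + 1 ≤ i + k → TorVanish R M (tensorPow R M i (ModuleCat.of R X)) from
    H (N + 1) i (by omega)
  intro k
  induction k with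
  | zero =>
    intro i hi
    have : Subsingleton (tensorPow R M i (ModuleCat.of R X)) :=
      tensorPow_subsingleton_of_le R M hi _ (tensorPow_subsingleton R M hN _)
    exact TorVanish.of_subsingleton R M
  | succ k ih =>
    intro i hi
    obtain ⟨h1, h2, h3⟩ := tpmap_exact R M (X := ModuleCat.of R (BTensor R M X))
      (Y := ModuleCat.of R X) (Z := ModuleCat.of R (Cok R M X)) hX (exact_mulMap_cokMk R M)
      (cokMk_surjective R M) h i
    -- The sequence is 0 → M^{⊗(i+1)} ⊗ X → M^{⊗i} ⊗ X → M^{⊗i} ⊗ X/MX → 0, exact by the Tor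
    -- vanishing for X/MX.
    exact TorVanish.of_exact R M h1 h2 h3
      ((ih (i + 1) (by omega)).of_equiv R M (tensorPowSucc R M (ModuleCat.of R X) i).symm) (h i)

/-- Nakayama's lemma. -/
theorem subsingleton_of_mulMap_surjective (h : Function.Surjective (mulMap R M X)) :
    Subsingleton X := by
  have hs : ∀ i, Function.Surjective
      -- If M X = X, then iterated multiplication M^{⊗ i} ⊗ X → X is onto for every i, and its
      -- source vanishes for i = N + 1.
      (powLift (M := M) (X := ModuleCat.of R X) (LinearMap.id : X →ₗ[R] X) i) := by
    intro i
    induction i with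
    | zero => exact Function.surjective_id
    | succ i ih => exact h.comp (btmap_surjective R M _ ih)
  have := tensorPow_subsingleton R M hN (ModuleCat.of R X)
  exact (hs (N + 1)).subsingleton

/-- The cokernel Z of f satisfies Z = M Z, so Nakayama's lemma applies to it. -/
theorem surjective_of_cokMap_surjective (f : Y →ₗ[TensorRing R M] X)
    (hf : Function.Surjective (cokMap R M f)) : Function.Surjective f := by
  have : Subsingleton (X ⧸ LinearMap.range f) := by
    refine subsingleton_of_mulMap_surjective hN fun z => ?_
    obtain ⟨x, rfl⟩ := Submodule.mkQ_surjective _ z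
    obtain ⟨c, hc⟩ := hf (cokMk R M X x)
    obtain ⟨y, rfl⟩ := cokMk_surjective R M c
    rw [cokMap_cokMk, ← sub_eq_zero, ← map_sub, cokMk_eq_zero] at hc
    obtain ⟨t, ht⟩ := hc
    refine ⟨btmap R M ((LinearMap.range f).mkQ.restrictScalars R) (-t), ?_⟩
    rw [← map_mulMap, map_neg, ht, neg_sub, map_sub, sub_eq_self]
    exact (Submodule.Quotient.mk_eq_zero _).2 ⟨y, rfl⟩
  rw [← LinearMap.range_eq_top]
  exact Submodule.Quotient.subsingleton_iff.1 this

end Phi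

/-! ### Covers and embeddings by induced modules -/

section Phi

variable {R : Type u} [Ring R]
variable {M : Type u} [AddCommGroup M] [Module R M] [Module Rᵐᵒᵖ M]

/-- `Ind(P) / M Ind(P) ≅ P`. -/
theorem exists_indCok_equiv (P : ModuleCat.{u} R) :
    ∃ ε : Cok R M (IndMod R M P) ≃ₗ[R] P, ∀ z, ε (cokMk R M _ z) = indProj R M P z := by
  obtain ⟨f, hf⟩ := exists_cok_desc R M (indProj R M P) ind_exact.apply_apply_eq_zero
  refine ⟨LinearEquiv.ofBijective f ⟨?_, fun x => ?_⟩, hf⟩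
  · rw [injective_iff_map_eq_zero]
    intro c hc
    obtain ⟨z, rfl⟩ := cokMk_surjective R M c
    rw [hf] at hc
    exact (cokMk_eq_zero R M).2 ((ind_exact z).1 hc)
  · obtain ⟨z, rfl⟩ := indProj_surjective (M := M) x
    exact ⟨_, hf z⟩

variable {X : Type u} [AddCommGroup X] [Module R X] [Module (TensorRing R M) X]
  [IsScalarTower R (TensorRing R M) X]

variable {N : ℕ} (hN : IsNilpotentBimodule R M N)
include hN

/-- A projective cover `P → X / M X` with kernel `G` lifts to a cover `Ind(P) → X`, whose kernel
`K` satisfies `K / M K ≅ G`. -/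
theorem exists_cover (hX : Function.Injective (mulMap R M X)) (hT : TorVanish R M X)
    (P G : ModuleCat.{u} R) [Module.Projective R P] (i : G →ₗ[R] P) (p : P →ₗ[R] Cok R M X)
    (hi : Function.Injective i) (hip : Function.Exact i p) (hp : Function.Surjective p) :
    ∃ F : IndMod R M P →ₗ[TensorRing R M] X, Function.Surjective F ∧
      Function.Injective (mulMap R M (LinearMap.ker F)) ∧
      Nonempty (G ≃ₗ[R] Cok R M (LinearMap.ker F)) := by
  obtain ⟨φ, hφ⟩ := Module.projective_lifting_property (cokMk R M X) p (cokMk_surjective R M)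
  have hφ' : ∀ x, cokMk R M X (φ x) = p x := fun x => LinearMap.congr_fun hφ x
  obtain ⟨ε, hε⟩ := exists_indCok_equiv (M := M) P
  let F := indLift (M := M) φ
  have hF : ∀ z, cokMk R M X (F z) = p (indProj R M P z) := fun z => by
    nth_rewrite 1 [← mulMap_indTail z]
    rw [map_add, map_add, map_mulMap, cokMk_mulMap, zero_add, ← hφ']
    exact congrArg _ (indLift_indBase φ _)
  have hcF : ∀ c, cokMap R M F c = p (ε c) := fun c => by
    obtain ⟨z, rfl⟩ := cokMk_surjective R M c
    rw [cokMap_cokMk, hF, hε]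
  have hFs : Function.Surjective F := surjective_of_cokMap_surjective hN F fun c => by
    obtain ⟨x, rfl⟩ := hp c
    exact ⟨ε.symm x, by rw [hcF, LinearEquiv.apply_symm_apply]⟩
  have hk := LinearMap.exact_subtype_ker_map F
  let K := LinearMap.ker F
  have hKM : Function.Injective (btmap R M (K.subtype.restrictScalars R)) :=
    -- Vanishing of Tor₁(M, X) embeds M ⊗ K in M ⊗ Ind(P), so K inherits an injective structure map
    -- from Ind(P).
    hT K (IndMod R M P) _ (F.restrictScalars R) K.subtype_injective hk hFs
  refine ⟨F, hFs, mulMap_injective_of_injective R M K.subtype hKM ind_mulMap_injective, ⟨?_⟩⟩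
  refine kernelEquiv i (ε.toLinearMap ∘ₗ cokMap R M K.subtype) p hi ?_ hip ?_
  · exact ε.injective.comp (cokMap_injective R M K.subtype F K.subtype_injective
      hk.apply_apply_eq_zero (btmap_exact R M (K.subtype.restrictScalars R) (F.restrictScalars R)
      hk hFs) hX)
  · have hex := cokMap_exact_of_surjective R M K.subtype F hk hFs
    intro x
    have h1 := hex (ε.symm x)
    rw [hcF, LinearEquiv.apply_symm_apply] at h1
    rw [h1]
    constructor
    · rintro ⟨c, hc⟩
      exact ⟨c, by rw [LinearMap.comp_apply, hc]; exact ε.apply_symm_apply x⟩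
    · rintro ⟨c, hc⟩
      exact ⟨c, by rw [← hc]; exact (ε.symm_apply_apply _).symm⟩

/-- A map `X → Ind(P)` that induces an injection `X / M X → P` with sufficiently flat cokernel is
injective. -/
theorem injective_of_layers (hX : Function.Injective (mulMap R M X))
    (hT : ∀ i, TorVanish R M (tensorPow R M i (ModuleCat.of R (Cok R M X))))
    {P G : ModuleCat.{u} R} {i : Cok R M X →ₗ[R] P} {p : P →ₗ[R] G}
    (hi : Function.Injective i) (hip : Function.Exact i p) (hp : Function.Surjective p)
    (hG : ∀ i, TorVanish R M (tensorPow R M i G)) (f : X →ₗ[TensorRing R M] IndMod R M P)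
    (hf : ∀ x, indProj R M P (f x) = i (cokMk R M X x)) : Function.Injective f := by
  let X' := ModuleCat.of R X
  let C := ModuleCat.of R (Cok R M X)
  let I := ModuleCat.of R (IndMod R M P)
  let MX := ModuleCat.of R (BTensor R M X)
  let MI := ModuleCat.of R (BTensor R M (IndMod R M P))
  let f' : X' →ₗ[R] I := f.restrictScalars R
  let Mf : MX →ₗ[R] MI := btmap R M f'
  let uX : MX →ₗ[R] X' := mulMap R M X
  let uI : MI →ₗ[R] I := mulMap R M (IndMod R M P)
  let q : X' →ₗ[R] C := cokMk R M X
  let π : I →ₗ[R] P := indProj R M P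
  let i' : C →ₗ[R] P := i
  -- The induction needs M^{⊗ j} ⊗ f for all j, not only f: injectivity in degree j follows from
  -- that in degree j + 1 and on the layer M^{⊗ j} ⊗ X/MX.
  suffices H : ∀ k j, N + 1 ≤ j + k → Function.Injective (tpmap R M f' j) from
    H (N + 1) 0 (by omega)
  intro k
  induction k with
  | zero =>
    intro j hj
    have : Subsingleton (tensorPow R M j X') :=
      tensorPow_subsingleton_of_le R M hj _ (tensorPow_subsingleton R M hN _)
    exact Function.injective_of_subsingleton _
  | succ k ih =>
    intro j hj
    rw [injective_iff_map_eq_zero]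
    intro y hy
    obtain ⟨-, h2, -⟩ := tpmap_exact R M (f := uX) (g := q) hX (exact_mulMap_cokMk R M)
      (cokMk_surjective R M) hT j
    obtain ⟨h3, -, -⟩ := tpmap_exact R M (f := i') (g := p) hi hip hp hG j
    have hcomm : π ∘ₗ f' = i' ∘ₗ q := LinearMap.ext hf
    -- An element of the kernel dies on the layer M^{⊗ j} ⊗ X/MX, which embeds in M^{⊗ j} ⊗ P, so it
    -- comes from M^{⊗ j} ⊗ (M ⊗ X).
    obtain ⟨t, rfl⟩ := (h2 y).1 (h3 (by
      rw [tpmap_tpmap, ← hcomm, ← tpmap_tpmap, hy, map_zero, map_zero]))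
    have hcomm' : f' ∘ₗ uX = uI ∘ₗ Mf := LinearMap.ext (map_mulMap R M f)
    rw [tpmap_tpmap, hcomm', ← tpmap_tpmap] at hy
    -- The structure map of Ind(P) is split over R, so it stays injective under M^{⊗ j} ⊗ - with no
    -- Tor condition.
    have ht : tpmap R M Mf j t = 0 :=
      tpmap_injective_of_leftInverse R M (indTail R M P : I →ₗ[R] MI) uI indTail_mulMap j
        (hy.trans (map_zero _).symm)
    have ht' : tpmap R M f' (j + 1) (tensorPowSucc R M X' j t) = 0 :=
      (tensorPowSucc_tpmap R M f' j t).symm.trans ((congrArg _ ht).trans (map_zero _))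
    have : t = 0 := (tensorPowSucc R M X' j).injective
      (ih (j + 1) (by omega) (ht'.trans (by rw [map_zero, map_zero])))
    rw [this, map_zero]

/-- An embedding `X / M X → P` with cokernel `G` lifts to an embedding `X → Ind(P)`, whose cokernel
`Y` satisfies `Y / M Y ≅ G`. -/
theorem exists_embedding (hX : Function.Injective (mulMap R M X))
    (hT : ∀ i, TorVanish R M (tensorPow R M i (ModuleCat.of R (Cok R M X))))
    (P G : ModuleCat.{u} R) (i : Cok R M X →ₗ[R] P) (p : P →ₗ[R] G)
    (hi : Function.Injective i) (hip : Function.Exact i p) (hp : Function.Surjective p)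
    (hG : ∀ i, TorVanish R M (tensorPow R M i G))
    (hE : ∀ i, ExtVanish R (Cok R M X) (tensorPow R M i P)) :
    ∃ f : X →ₗ[TensorRing R M] IndMod R M P, Function.Injective f ∧
      Function.Injective (mulMap R M (IndMod R M P ⧸ LinearMap.range f)) ∧
      Nonempty (G ≃ₗ[R] Cok R M (IndMod R M P ⧸ LinearMap.range f)) := by
  let a : X →ₗ[TensorRing R M] TrivMod R M P :=
    homOfCommute (show X →ₗ[R] TrivMod R M P from i ∘ₗ cokMk R M X) fun m x => by
      rw [PairMod.bimoduleIncl_smul (zeroStr R M P)]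
      exact (congrArg i (cokMk_mulMap R M (btmul R m x))).trans (map_zero i)
  -- The obstruction to lifting X → X/MX → P to Ind(P) lies in Ext¹(X, Ind(M ⊗ P)), which is the
  -- case i = 1 of `extVanish_indMod`.
  obtain ⟨f, hfa⟩ : ∃ f : X →ₗ[TensorRing R M] IndMod R M P, ∀ x, indAug R M P (f x) = a x :=
    ExtVanish.lift indShift_injective indShift_exact indAug_surjective
      (extVanish_indMod hN hX P hE 1) a
  have hf : ∀ x, indProj R M P (f x) = i (cokMk R M X x) := hfa
  have hfi := injective_of_layers hN hX hT hi hip hp hG f hf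
  obtain ⟨ε, hε⟩ := exists_indCok_equiv (M := M) P
  let q := (LinearMap.range f).mkQ
  have hq : Function.Surjective q := Submodule.mkQ_surjective _
  have hfq : Function.Exact f q := LinearMap.exact_map_mkQ_range f
  refine ⟨f, hfi, ?_, ⟨?_⟩⟩
  · rw [injective_iff_map_eq_zero]
    intro t ht
    obtain ⟨t, rfl⟩ := btmap_surjective R M (q.restrictScalars R) hq t
    rw [← map_mulMap] at ht
    obtain ⟨x, hx⟩ := (hfq _).1 ht
    -- If f x lies in M Ind(P), then x lies in M X because X/MX embeds in P. This puts t in the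
    -- image of M ⊗ X, so it vanishes in the tensor product with the quotient.
    have h0 : cokMk R M X x = 0 := hi (by
      rw [← hf, hx, ind_exact.apply_apply_eq_zero, map_zero])
    obtain ⟨s, rfl⟩ := (cokMk_eq_zero R M).1 h0
    rw [map_mulMap] at hx
    rw [← ind_mulMap_injective hx, btmap_btmap]
    exact btmap_eq_zero R M _ hfq.apply_apply_eq_zero s
  · have hex := cokMap_exact_of_surjective R M f q hfq hq
    refine cokernelEquiv p (cokMap R M q ∘ₗ ε.symm.toLinearMap) i hp ?_ hip ?_
    · refine Function.Surjective.comp (g := cokMap R M q) (fun c => ?_) ε.symm.surjective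
      obtain ⟨z, rfl⟩ := cokMk_surjective R M c
      obtain ⟨z, rfl⟩ := hq z
      exact ⟨cokMk R M _ z, rfl⟩
    · have hcf : ∀ c, ε (cokMap R M f c) = i c := fun c => by
        obtain ⟨x, rfl⟩ := cokMk_surjective R M c
        rw [cokMap_cokMk, hε, hf]
      intro x
      refine (hex (ε.symm x)).trans (exists_congr fun c => ?_)
      rw [LinearEquiv.eq_symm_apply, hcf]

end Phi

/-! ### The two inclusions -/

section Main

variable {R : Type u} [Ring R]
variable {M : Type u} [AddCommGroup M] [Module R M] [Module Rᵐᵒᵖ M]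

attribute [local instance] baseModule baseModule_isScalarTower

/-- Membership in `Φ(𝒳)` may be checked with any compatible `R`-module structure. -/
theorem phi_of_mulMap (𝒳 : ObjectProperty (ModuleCat.{u} R)) (X : Type u) [AddCommGroup X]
    [inst : Module R X] [Module (TensorRing R M) X] [IsScalarTower R (TensorRing R M) X]
    (h : Function.Injective (mulMap R M X)) (hc : 𝒳 (ModuleCat.of R (Cok R M X))) :
    Phi R M 𝒳 (ModuleCat.of (TensorRing R M) X) := by
  have e : inst = Module.compHom X (baseHom R M) :=
    Module.ext' _ _ fun r x => (baseHom_smul R M r x).symm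
  subst e
  exact ⟨h, hc⟩

theorem mulMap_of_phi {𝒳 : ObjectProperty (ModuleCat.{u} R)} {X : ModuleCat.{u} (TensorRing R M)}
    (h : Phi R M 𝒳 X) :
    Function.Injective (mulMap R M X) ∧ 𝒳 (ModuleCat.of R (Cok R M X)) := h

theorem phi_of_gp (hc : IsCompatible R M M) {X : ModuleCat.{u} (TensorRing R M)}
    (hX : GP (TensorRing R M) X) : Phi R M (GP R) X := by
  obtain ⟨Q, j, e, he, hed⟩ := isSyzygy_of_gp hX
  have h : Function.Injective (mulMap R M X) ∧ GP R (ModuleCat.of R (Cok R M X)) :=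
    mulMap_injective_and_gp_cok Q (hc Q).1 (hc Q).2 j e he hed
  exact h

theorem gp_of_phi {N : ℕ} (hN : IsNilpotentBimodule R M N) (ha : IsAdmissible R M)
    {X : ModuleCat.{u} (TensorRing R M)} (hX : Phi R M (GP R) X) : GP (TensorRing R M) X := by
  have hTor : ∀ G : ModuleCat.{u} R, GP R G → ∀ i, TorVanish R M (tensorPow R M i G) :=
    fun G hG i => torVanish_of_subsingleton_tor R M _
      (ha G hG (ModuleCat.of R R) (inferInstanceAs (Module.Projective R R)) i).2
  have hExt : ∀ G : ModuleCat.{u} R, GP R G → ∀ P : ModuleCat.{u} R, Module.Projective R P →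
      ∀ i, ExtVanish R G (tensorPow R M i P) :=
    fun G hG P hP i => extVanish_of_subsingleton_ext _ _ (ha G hG P hP i).1
  refine gp_of_steps (Phi R M (GP R)) (fun W hW => ?_) (fun W hW => ?_) X hX
  · obtain ⟨hu, hG⟩ := mulMap_of_phi hW
    -- The extension property over R is dropped here: over T_R(M) it follows from Ext¹ vanishing for
    -- the right-hand end, which is the new cokernel in this direction and W itself in the other.
    obtain ⟨G', hG', P, i, p, hP, hi, hip, hp, -⟩ := hG.exists_next
    obtain ⟨f, hf, hu', ⟨e⟩⟩ := exists_embedding hN hu (hTor _ hG) P G' i p hi hip hp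
      (hTor _ hG') (hExt _ hG P hP)
    have hG'' := hG'.of_equiv (G' := ModuleCat.of R (Cok R M (IndMod R M P ⧸ LinearMap.range f))) e
    refine ⟨ModuleCat.of _ (IndMod R M P ⧸ LinearMap.range f), phi_of_mulMap _ _ hu' hG'',
      ModuleCat.of _ (IndMod R M P), f, (LinearMap.range f).mkQ,
      inferInstanceAs (Module.Projective (TensorRing R M) (IndMod R M P)), hf,
      LinearMap.exact_map_mkQ_range f, Submodule.mkQ_surjective _, fun Q hQ g => ?_⟩
    exact (extVanish_projective hN hu' (hExt _ hG'') Q).extend hf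
      (LinearMap.exact_map_mkQ_range f) (Submodule.mkQ_surjective _) g
  · obtain ⟨hu, hG⟩ := mulMap_of_phi hW
    obtain ⟨G', hG', P, i, p, hP, hi, hip, hp, -⟩ := hG.exists_prev
    obtain ⟨F, hF, hu', ⟨e⟩⟩ := exists_cover hN hu (torVanish_of_cok hN hu (hTor _ hG) 0)
      P G' i p hi hip hp
    refine ⟨ModuleCat.of _ (LinearMap.ker F), phi_of_mulMap _ _ hu'
      (hG'.of_equiv (G' := ModuleCat.of R (Cok R M (LinearMap.ker F))) e),
      ModuleCat.of _ (IndMod R M P), (LinearMap.ker F).subtype, F,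
      inferInstanceAs (Module.Projective (TensorRing R M) (IndMod R M P)),
      Submodule.subtype_injective _, LinearMap.exact_subtype_ker_map F, hF, fun Q hQ g => ?_⟩
    exact (extVanish_projective hN hu (hExt _ hG) Q).extend (Submodule.subtype_injective _)
      (LinearMap.exact_subtype_ker_map F) hF g

end Main

end TensorRingGP

end

theorem mainTheorem3 (R : Type u) [Ring R]
    (M : Type u) [AddCommGroup M] [Module R M] [Module Rᵐᵒᵖ M] [SMulCommClass R Rᵐᵒᵖ M]
    (N : ℕ) (hN : TensorRingGP.IsNilpotentBimodule R M N)
    (hcompatible : TensorRingGP.IsCompatible R M M)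
    (hadmissible : TensorRingGP.IsAdmissible R M) :
    TensorRingGP.GP (TensorRingGP.TensorRing R M) =
      TensorRingGP.Phi R M (TensorRingGP.GP R) := by
  ext X
  exact ⟨TensorRingGP.phi_of_gp hcompatible, TensorRingGP.gp_of_phi hN hadmissible⟩
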